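/- Setting. There are $n$ players in a complete synchronous network, a fixed set of them honest and the others, fewer than $n/3$, malicious; $h$ is the ratio of honest players. Honest player $i$ observes $x_i\in(V\cup\{\bot\})^m$, and component $c$ is \emph{ambiguous} if $x_{i,c}\neq x_{j,c}$ for some honest $i,j$; $l$ is the number of ambiguous components. Honest players send the same message to everybody. A rushing adversary with private randomness chooses the messages of the malicious players, separately for each receiver, without knowing honest signatures that have not been revealed. $\#_i(v,c)$ is the number of players (including $i$) from which $i$ receives, in the current step, a vector with $c$-th entry $v$. MBA protocol. (Graded consensus) Each $i$ sends $x_i$; then $i$ sends $\tilde v_i$, where $\tilde v_{i,c}=v$ if $\#_i(v,c)\ge\lfloor 2n/3\rfloor+1$, and $\tilde v_{i,c}=\bot$ if there is no such $v$; then $i$ sets $b_{i,c}=0$ if $\#_i(v,c)\ge\lfloor 2n/3\rfloor+1$ for some $v\ne\bot$, and $b_{i,c}=1$ otherwise. All flags $f_{i,c}$ start at $0$. (MBBA) The following loop is iterated, with counter $\gamma=0,1,2,\dots$; in each step player $i$ sends $b_i$ and updates the components $c$ with $f_{i,c}=0$. Step 1: if $\#_i(0,c)>\frac23n$ set $b_{i,c}=0$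 and $f_{i,c}=1$; else if $\#_i(1,c)>\frac23n$ set $b_{i,c}=1$; else set $b_{i,c}=0$. Step 2: the same with $0$ and $1$ exchanged. Step 3: each $i$ also sends its unique signature $s_i=\mathrm{SIG}_i(r\|\gamma)$ on a common string $r$ and the counter; if $\#_i(0,c)>\frac23n$ set $b_{i,c}=0$; else if $\#_i(1,c)>\frac23n$ set $b_{i,c}=1$; else let $b_{i,c}$ be the $c$-th bit of $H(\min_{j\in P_i}H(s_j))$, where $P_i$ is the set of players whose valid signature $i$ has received in this step. A player halts as soon as all its flags are $1$; from then on its vector $b_i$ counts as its message in every step, but it sends no signatures. Signatures are ideal (unique and unforgeable), and $H$ is an ideal random oracle: its answers to distinct queries are independent uniformly random bit strings, long enough that collisions have probability zero, ordered lexicographically. Coin game. $N$ coins, each landing heads with probability $\pi$, are flipped independently; at each step all remaining coins are flipped and those showing heads are discarded. Let $\chi_{N,\pi}$ be the number of steps until no coin is left. Theorem. (1) For all $N\ge 0$, $\pi\in[0,1]$ and integers $w\ge0$, $P(\chi_{N,\pi}>w)=1-\bigl(1-(1-\pi)^w\bigr)^N$ (with $0^0=1$). (2) For all inputs and every strategy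 of the adversary, the number $T\in\{0,1,2,\dots\}\cup\{\infty\}$ of MBBA iterations (the last one possibly incomplete) until all honest players have halted in a run of MBA is stochastically dominated by $1+\chi_{l,h/2}$: for every integer $k\ge0$, $$P(T>k)\le P\bigl(1+\chi_{l,h/2}>k\bigr).$$ -/

import Mathlib

open MeasureTheory

noncomputable section

namespace MBA

open scoped Classical

/-! ### The coin game -/

/-- The flips of the game: `flips s j` is the outcome (`true` is heads) of coin `j` at step `s`.
All flips are independent and show heads with probability `p`. -/
def gameMeasure (N : ℕ) (p : unitInterval) : Measure (ℕ → Fin N → Bool) :=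
  Measure.infinitePi fun _ : ℕ =>
    Measure.infinitePi fun _ : Fin N => ProbabilityTheory.bernoulliMeasure true false p

/-- The coins that are still in play after `w` steps: at each step the remaining coins are flipped,
and those which show heads are discarded. -/
def remainingCoins {N : ℕ} (flips : ℕ → Fin N → Bool) : ℕ → Finset (Fin N)
  | 0 => Finset.univ
  | w + 1 => (remainingCoins flips w).filter fun j => flips w j = false

/-- The number of steps of the game (the random variable `χ`): the first `w` such that no coin is
left after `w` steps, and `⊤` if there is none. -/
def gameLength {N : ℕ} (flips : ℕ → Fin N → Bool) : ℕ∞ :=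
  sInf {k : ℕ∞ | ∃ w : ℕ, k = w ∧ remainingCoins flips w = ∅}

/-! ### The random oracle -/

/-- Outputs of the hash function: bit strings, long enough (infinite) for collisions between
distinct queries to have probability zero. They are ordered lexicographically. -/
abbrev Digest : Type := ℕ → Bool

/-- A uniformly random digest: independent fair bits. -/
def uniformDigest : Measure Digest :=
  Measure.infinitePi fun _ : ℕ =>
    ProbabilityTheory.bernoulliMeasure true false ⟨1 / 2, by norm_num, by norm_num⟩

instance : IsProbabilityMeasure uniformDigest := by
  unfold uniformDigest; infer_instance

/-- The values of the random oracle `H` that matter in a run. A pair `(γ, j)` stands for the unique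
signature `s = SIG_j(r‖γ)` of player `j` on the common string `r` followed by the counter `γ`, and
the entry at `(γ, j)` is the pair `(H(s), H(H(s)))`. -/
abbrev Oracle (n : ℕ) : Type := ℕ × Fin n → Digest × Digest

/-- The law of the random oracle: the answers to distinct queries are independent and uniform. -/
def oracleMeasure (n : ℕ) : Measure (Oracle n) :=
  Measure.infinitePi fun _ : ℕ × Fin n => uniformDigest.prod uniformDigest

/-! ### Messages -/

/-- A choice of messages from every sender (first argument) to every receiver (second argument);
`none` means that no valid message is sent. -/
abbrev Mail (n : ℕ) (M : Type*) : Type _ := Fin n → Fin n → Option M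

/-- What player `i` receives in one step, indexed by the sender: every honest player `j` sends the
same message `own j` to everybody (also to itself), the malicious players send what they like. -/
def deliver {n : ℕ} {M : Type*} (honest : Finset (Fin n)) (own : Fin n → Option M)
    (adv : Mail n M) (i : Fin n) : Fin n → Option M :=
  fun j => if j ∈ honest then own j else adv j i

/-- `#_i(v, c)`: the number of players from which a vector with `c`-th entry `v` was received. -/
def count {n m : ℕ} {α : Type*} (inbox : Fin n → Option (Fin m → α)) (v : α) (c : Fin m) : ℕ :=
  (Finset.univ.filter fun j => ∃ msg, inbox j = some msg ∧ msg c = v).card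

/-! ### The adversary

The set of malicious players is fixed; they are coordinated by one adversary, which chooses
separately for each receiver what each of them sends. -/

/-- What the adversary has learned when `γ` values of the counter have been revealed: the oracle at
all signatures of malicious players (for every value of the counter, also in the future), the oracle
at the signatures of honest players for the first `γ` values of the counter, and a private random
seed. The messages of the honest players so far need not be listed, since they are functions of the
inputs, of the adversary's own earlier messages, and of these oracle values. -/
abbrev View {n : ℕ} (honest : Finset (Fin n)) (R : Type*) (γ : ℕ) : Type _ :=
  ({q : ℕ × Fin n // q.2 ∉ honest ∨ q.1 < γ} → Digest × Digest) × R

/-- Restriction of the oracle and the seed to what the adversary knows. -/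
def view {n : ℕ} (honest : Finset (Fin n)) {R : Type*} (γ : ℕ) (ω : Oracle n × R) :
    View honest R γ :=
  (fun q => ω.1 q.1, ω.2)

/-- A strategy of the adversary. It is rushing: in the third step of iteration `γ` it knows the
honest signatures of that very iteration before it chooses its messages. In that step a message is a
bit vector and a flag telling whether the sender's unique valid signature is attached (a message
`v⋆` counts later as a vector `v` without a signature). The sets of messages are discrete. -/
structure Adversary {n : ℕ} (honest : Finset (Fin n)) (m : ℕ) (V R : Type*)
    [MeasurableSpace R] where
  gc1 : View honest R 0 → Mail n (Fin m → Option V)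
  gc2 : View honest R 0 → Mail n (Fin m → Option V)
  fixed0 : ∀ γ : ℕ, View honest R γ → Mail n (Fin m → Bool)
  fixed1 : ∀ γ : ℕ, View honest R γ → Mail n (Fin m → Bool)
  flip : ∀ γ : ℕ, View honest R (γ + 1) → Mail n ((Fin m → Bool) × Bool)
  measurable_gc1 : @Measurable _ _ _ ⊤ gc1
  measurable_gc2 : @Measurable _ _ _ ⊤ gc2
  measurable_fixed0 : ∀ γ, @Measurable _ _ _ ⊤ (fixed0 γ)
  measurable_fixed1 : ∀ γ, @Measurable _ _ _ ⊤ (fixed1 γ)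
  measurable_flip : ∀ γ, @Measurable _ _ _ ⊤ (flip γ)

/-! ### Multidimensional graded consensus (MGC)

Values are elements of `Option V`, where `none` is the special symbol `⊥`. -/

/-- The vector sent in the second step of MGC, from what was received in the first step. -/
def gcEcho {n m : ℕ} {V : Type*} (inbox : Fin n → Option (Fin m → Option V)) :
    Fin m → Option V :=
  fun c => if hv : ∃ v : Option V, 2 * n / 3 + 1 ≤ count inbox v c then hv.choose else none

/-- The value-grade pairs output by MGC, from what was received in the second step. -/
def gcOutput {n m : ℕ} {V : Type*} (inbox : Fin n → Option (Fin m → Option V)) :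
    Fin m → Option V × ℕ :=
  fun c =>
    if h2 : ∃ v : V, 2 * n / 3 + 1 ≤ count inbox (some v) c then (some h2.choose, 2)
    else if h1 : ∃ v : V, n / 3 + 1 ≤ count inbox (some v) c then (some h1.choose, 1)
    else (none, 0)

/-- The output of MGC for all players, with inputs `x`. Here and below only the entries at honest
players are meaningful. -/
def mgc {n m : ℕ} {V : Type*} (honest : Finset (Fin n)) (x : Fin n → Fin m → Option V)
    (adv1 adv2 : Mail n (Fin m → Option V)) : Fin n → Fin m → Option V × ℕ :=
  fun i => gcOutput (deliver honest
    (fun j => some (gcEcho (deliver honest (fun j' => some (x j')) adv1 j))) adv2 i)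

/-! ### Multidimensional binary Byzantine agreement (MBBA) -/

/-- The local variables of a player: the bits `b_{i,c}` and the flags `f_{i,c}` of the components
that are final (`true` is `1`, `false` is `0`). -/
structure LocalState (m : ℕ) where
  bits : Fin m → Bool
  final : Fin m → Bool

/-- The exit check: a player has halted as soon as all its components are final. A halted player
changes nothing any more, and since it has sent `b_i⋆`, the vector `b_i` is still counted as its
message in all the following steps. -/
def LocalState.Halted {m : ℕ} (s : LocalState m) : Prop := ∀ c, s.final c = true

/-- Step 1 (Coin-Fixed-To-0). -/
def coinFixed0 {n m : ℕ} (honest : Finset (Fin n)) (adv : Mail n (Fin m → Bool))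
    (S : Fin n → LocalState m) : Fin n → LocalState m :=
  fun i =>
    let inbox := deliver honest (fun j => some (S j).bits) adv i
    { bits := fun c =>
        if (S i).final c = true then (S i).bits c
        else if 2 * n < 3 * count inbox false c then false
        else if 2 * n < 3 * count inbox true c then true
        else false
      final := fun c =>
        if (S i).final c = true then true
        else if 2 * n < 3 * count inbox false c then true
        else false }

/-- Step 2 (Coin-Fixed-To-1). -/
def coinFixed1 {n m : ℕ} (honest : Finset (Fin n)) (adv : Mail n (Fin m → Bool))
    (S : Fin n → LocalState m) : Fin n → LocalState m :=
  fun i =>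
    let inbox := deliver honest (fun j => some (S j).bits) adv i
    { bits := fun c =>
        if (S i).final c = true then (S i).bits c
        else if 2 * n < 3 * count inbox true c then true
        else if 2 * n < 3 * count inbox false c then false
        else true
      final := fun c =>
        if (S i).final c = true then true
        else if 2 * n < 3 * count inbox true c then true
        else false }

/-- The string `k = H(min_{j ∈ P} H(s_j))`, where `s_j` is the signature of player `j` for the
counter `γ` (if `P` is empty, which does not happen to an active player, it is all zero). -/
def coinString {n : ℕ} (H : Oracle n) (γ : ℕ) (P : Finset (Fin n)) : Digest :=
  if hP : P.Nonempty then
    (H (γ, (P.exists_min_image (fun j => toLex (H (γ, j)).1) hP).choose)).2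
  else fun _ => false

/-- Step 3 (Coin-Genuinely-Flipped). A player that has halted does not send a signature any more. -/
def coinFlipped {n m : ℕ} (honest : Finset (Fin n)) (H : Oracle n) (γ : ℕ)
    (adv : Mail n ((Fin m → Bool) × Bool)) (S : Fin n → LocalState m) : Fin n → LocalState m :=
  fun i =>
    let received := deliver honest
      (fun j => some ((S j).bits, if (S j).Halted then false else true)) adv i
    let inbox : Fin n → Option (Fin m → Bool) := fun j => (received j).map Prod.fst
    let P : Finset (Fin n) := Finset.univ.filter fun j => ∃ b, received j = some (b, true)
    { bits := fun c =>
        if (S i).final c = true then (S i).bits c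
        else if 2 * n < 3 * count inbox false c then false
        else if 2 * n < 3 * count inbox true c then true
        else coinString H γ P c
      final := (S i).final }

/-! ### The run of MBA -/

/-- The states with which the players enter MBBA after graded consensus: `b_{i,c} = 0` if the grade
is `2` and `b_{i,c} = 1` otherwise, and no component is final. -/
def initialState {n m : ℕ} {V R : Type*} [MeasurableSpace R] (honest : Finset (Fin n))
    (x : Fin n → Fin m → Option V) (A : Adversary honest m V R) (ω : Oracle n × R) :
    Fin n → LocalState m :=
  let out := mgc honest x (A.gc1 (view honest 0 ω)) (A.gc2 (view honest 0 ω))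
  fun i =>
    { bits := fun c => if (out i c).2 = 2 then false else true
      final := fun _ => false }

/-- The states of the players in a run of MBA after `γ` iterations of the MBBA loop. -/
def stateAfter {n m : ℕ} {V R : Type*} [MeasurableSpace R] (honest : Finset (Fin n))
    (x : Fin n → Fin m → Option V) (A : Adversary honest m V R) (ω : Oracle n × R) :
    ℕ → Fin n → LocalState m
  | 0 => initialState honest x A ω
  | γ + 1 =>
    coinFlipped honest ω.1 γ (A.flip γ (view honest (γ + 1) ω))
      (coinFixed1 honest (A.fixed1 γ (view honest γ ω))
        (coinFixed0 honest (A.fixed0 γ (view honest γ ω)) (stateAfter honest x A ω γ)))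

/-- The number of MBBA iterations required to end the run of MBA (the last one may be cut short):
the first `γ` such that all honest players have halted after `γ` iterations, `⊤` if there is none. -/
def iterations {n m : ℕ} {V R : Type*} [MeasurableSpace R] (honest : Finset (Fin n))
    (x : Fin n → Fin m → Option V) (A : Adversary honest m V R) (ω : Oracle n × R) : ℕ∞ :=
  sInf {k : ℕ∞ | ∃ γ : ℕ, k = γ ∧ ∀ i ∈ honest, (stateAfter honest x A ω γ i).Halted}

/-- A component is ambiguous if two honest players observe distinct values in it. -/
def ambiguous {n m : ℕ} {V : Type*} (honest : Finset (Fin n)) (x : Fin n → Fin m → Option V) :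
    Finset (Fin m) :=
  Finset.univ.filter fun c => ∃ i ∈ honest, ∃ j ∈ honest, x i c ≠ x j c

/-- `h / 2`, where `h` is the ratio of honest players. -/
def halfHonestRatio {n : ℕ} (honest : Finset (Fin n)) : unitInterval :=
  ⟨((honest.card : ℝ) / n) / 2, by positivity, by
    have h : (honest.card : ℝ) ≤ n := by
      exact_mod_cast (Finset.card_le_univ honest).trans_eq (Fintype.card_fin n)
    have h1 : (honest.card : ℝ) / n ≤ 1 := div_le_one_of_le₀ h (Nat.cast_nonneg n)
    linarith⟩

end MBA

end

namespace MBA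
open scoped Classical

/-! ### Weighted counting of bit patterns -/

/-! The coin game ends by time `w` exactly when each of the `N` columns of flips shows a head among
its first `w` entries. The columns are independent and each succeeds with probability `1 - (1 - π) ^
w`, which is the first claim.

For the protocol, the deterministic half is about quorums. With fewer than `n / 3` malicious
players, agreement of the honest players on a component is never lost, a final component is already
agreed upon (`Sound`), and unambiguous components agree from the start (`agree_initialState`). Once
all components agree, the next iteration halts everybody (`halted_of_agree`); this is the summand
`1`. Suppose that in some iteration an honest player has the strictly smallest first hash among all
players. As long as some component is not agreed upon, that player is still active, so all honest
players receive its signature and use the same coin. At most one bit can reach a quorum at any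
honest player in step 3, so a coin equal to that bit (`goodBit`) produces agreement
(`agree_coinFlipped_of_goodBit`).

In the probabilistic half, the smallest hash is honest with probability `h` in each iteration,
independently (`oracleMeasure_honestMin_pattern`). The right value of the coin is fixed before the
second hash of the honest winner becomes known to the adversary. Resampling this hash shows that,
over all iterations and components, the events "the coin is right" are fair and independent of each
other and of all first hashes (`prod_inter_coinRight_pattern`).

Components are not independent of each other, however, since all of them share the event that the
smallest hash is honest. If `K` of the first `w` iterations have an honest winner, then
conditionally all `l` ambiguous components meet a right coin with probability `(1 - 2 ^ (-K)) ^ l`.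
The mean of `2 ^ (-K)` is `(1 - h / 2) ^ w`, so by Jensen's inequality the average is at least `(1 -
(1 - h / 2) ^ w) ^ l`, the probability that the coin game is over (`le_sum_weights`). -/

lemma sum_prod_bernoulli_weights {ι : Type*} [Fintype ι] [DecidableEq ι] (p : ℝ) :
    ∑ b : ι → Bool, ∏ i, (if b i = true then p else 1 - p) = 1 := by
  have h := Finset.prod_univ_sum (fun _ : ι => (Finset.univ : Finset Bool))
    (fun _ b => if b = true then p else 1 - p)
  rw [Fintype.piFinset_univ] at h
  rw [← h]
  simp

lemma sum_weights_hit {w : ℕ} (p : ℝ) (g : Fin w → Bool) :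
    ∑ b : Fin w → Bool, (if ∃ s, g s = true ∧ b s = true then
        ∏ s, (if b s = true then p else 1 - p) else 0) =
      1 - ∏ s, (if g s = true then 1 - p else 1) := by
  -- The complementary event, no head in a marked row, is a product set, so its weight factors over
  -- the rows.
  have h := Finset.prod_univ_sum
    (fun s : Fin w => (Finset.univ.filter fun b : Bool => ¬ (g s = true ∧ b = true)))
    (fun _ b => if b = true then p else 1 - p)
  have h2 : ∀ s, ∑ b ∈ Finset.univ.filter (fun b : Bool => ¬ (g s = true ∧ b = true)),
      (if b = true then p else 1 - p) = if g s = true then 1 - p else 1 := by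
    intro s
    rw [Finset.sum_filter]
    cases g s <;> simp
  rw [Finset.prod_congr rfl fun s _ => h2 s] at h
  rw [h, eq_sub_iff_add_eq, ← Finset.sum_filter]
  refine Eq.trans ?_ (sum_prod_bernoulli_weights (ι := Fin w) p)
  rw [← Finset.sum_filter_add_sum_filter_not Finset.univ
    (fun b : Fin w → Bool => ∃ s, g s = true ∧ b s = true)]
  congr 1
  refine Finset.sum_congr ?_ fun _ _ => rfl
  ext b
  simp [Fintype.mem_piFinset]

/-- The total weight of the patterns in which every column in `C` shows a head in one of the rows
marked by `g`. -/
lemma sum_weights_columns {w N : ℕ} (p : ℝ) (g : Fin w → Bool) (C : Finset (Fin N)) :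
    ∑ a : Fin w → Fin N → Bool,
      (if ∀ c ∈ C, ∃ s, g s = true ∧ a s c = true then
        ∏ s, ∏ c, (if a s c = true then p else 1 - p) else 0) =
      (1 - ∏ s, (if g s = true then 1 - p else 1)) ^ C.card := by
  -- The condition is imposed column by column, so it can be absorbed into the factor of each column
  -- before expanding the product of sums.
  have key := Finset.prod_univ_sum (fun _ : Fin N => (Finset.univ : Finset (Fin w → Bool)))
    (fun c b => if c ∈ C → ∃ s, g s = true ∧ b s = true then
        ∏ s, (if b s = true then p else 1 - p) else 0)
  rw [Fintype.piFinset_univ] at key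
  have hcol : ∀ c : Fin N, ∑ b : Fin w → Bool, (if c ∈ C → ∃ s, g s = true ∧ b s = true then
        ∏ s, (if b s = true then p else 1 - p) else 0) =
      if c ∈ C then 1 - ∏ s, (if g s = true then 1 - p else 1) else 1 := by
    intro c
    by_cases hc : c ∈ C
    · simp only [hc, forall_true_left, if_true]
      exact sum_weights_hit p g
    · simp only [hc, IsEmpty.forall_iff, if_true, if_false]
      exact sum_prod_bernoulli_weights p
  rw [Finset.prod_congr rfl fun c _ => hcol c] at key
  rw [Finset.prod_ite_mem, Finset.univ_inter, Finset.prod_const] at key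
  rw [key]
  refine Fintype.sum_equiv (Equiv.piComm fun _ _ => Bool) _ _ fun a => ?_
  simp only [Equiv.piComm_apply, Function.swap]
  rw [Finset.prod_ite_zero]
  simp only [Finset.mem_univ, forall_true_left]
  rw [Finset.prod_comm]

/-! ### The length of the coin game -/

lemma mem_remainingCoins {N : ℕ} (flips : ℕ → Fin N → Bool) (w : ℕ) (j : Fin N) :
    j ∈ remainingCoins flips w ↔ ∀ s < w, flips s j = false := by
  induction w with
  | zero => simp [remainingCoins]
  | succ w ih => simp only [remainingCoins, Finset.mem_filter, ih, Nat.forall_lt_succ_right]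

lemma lt_sInf_natCast_iff {p : ℕ → Prop} (hp : ∀ a b, a ≤ b → p a → p b) (w : ℕ) :
    (w : ℕ∞) < sInf {k : ℕ∞ | ∃ v : ℕ, k = v ∧ p v} ↔ ¬ p w := by
  constructor
  · intro h hw
    exact (not_le.mpr h) (sInf_le ⟨w, rfl, hw⟩)
  · intro h
    have : ((w + 1 : ℕ) : ℕ∞) ≤ sInf {k : ℕ∞ | ∃ v : ℕ, k = v ∧ p v} := by
      refine le_sInf ?_
      rintro k ⟨v, rfl, hv⟩
      by_contra hlt
      have hvw : v < w + 1 := by exact_mod_cast not_le.mp hlt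
      exact h (hp v w (by omega) hv)
    exact lt_of_lt_of_le (by exact_mod_cast Nat.lt_succ_self w) this

lemma lt_gameLength_iff {N : ℕ} (flips : ℕ → Fin N → Bool) (w : ℕ) :
    (w : ℕ∞) < gameLength flips ↔ ¬ ∀ j, ∃ s : Fin w, flips s j = true := by
  unfold gameLength
  have hiff : ∀ v, remainingCoins flips v = ∅ ↔ ∀ j, ∃ s < v, flips s j = true := by
    intro v
    simp [Finset.eq_empty_iff_forall_notMem, mem_remainingCoins]
  rw [lt_sInf_natCast_iff]
  · rw [hiff]
    simp [Fin.exists_iff]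
  · intro a b hab ha
    rw [hiff] at ha ⊢
    intro j
    obtain ⟨s, hs, h⟩ := ha j
    exact ⟨s, hs.trans_le hab, h⟩

instance (N : ℕ) (p : unitInterval) : IsProbabilityMeasure (gameMeasure N p) := by
  unfold gameMeasure; infer_instance

lemma bernoulliMeasure_real_singleton (p : unitInterval) (b : Bool) :
    (ProbabilityTheory.bernoulliMeasure true false p).real {b} =
      if b = true then (p : ℝ) else 1 - p := by
  rw [ProbabilityTheory.bernoulliMeasure_real_apply p (measurableSet_singleton b)]
  cases b <;> simp

lemma gameMeasure_pattern {N : ℕ} (p : unitInterval) {w : ℕ} (a : Fin w → Fin N → Bool) :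
    (gameMeasure N p).real ((fun flips (s : Fin w) => flips s) ⁻¹' {a}) =
      ∏ s, ∏ c, (if a s c = true then (p : ℝ) else 1 - p) := by
  -- The quantifier over proofs of `s < w` extends `a` to a family of sets indexed by all of `ℕ`,
  -- trivial beyond `w`, as the product measure requires.
  have hset : (fun (flips : ℕ → Fin N → Bool) (s : Fin w) => flips s) ⁻¹' {a} =
      Set.pi (Finset.range w : Set ℕ) fun s => {b | ∀ h : s < w, b = a ⟨s, h⟩} := by
    ext flips
    simp only [Set.mem_preimage, Set.mem_singleton_iff, funext_iff (f := fun s : Fin w => flips s),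
      Set.mem_pi, Finset.coe_range, Set.mem_Iio, Set.mem_ofPred_eq, Fin.forall_iff]
    exact ⟨fun h s hs _ => h s hs, fun h s hs => h s hs hs⟩
  rw [hset, gameMeasure, measureReal_def,
    Measure.infinitePi_pi _ (fun _ _ => Set.Finite.measurableSet (Set.toFinite _)),
    ENNReal.toReal_prod, Finset.prod_range]
  refine Finset.prod_congr rfl fun s _ => ?_
  have : {b : Fin N → Bool | ∀ h : (s : ℕ) < w, b = a ⟨s, h⟩} = {a s} := by
    ext b; simp
  rw [this, Measure.infinitePi_singleton_of_fintype, ENNReal.toReal_prod]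
  refine Finset.prod_congr rfl fun c _ => ?_
  exact bernoulliMeasure_real_singleton p (a s c)

/-- The distribution of the length of the coin game. -/
theorem gameMeasure_lt_gameLength (N : ℕ) (p : unitInterval) (w : ℕ) :
    (gameMeasure N p).real {flips | (w : ℕ∞) < gameLength flips} =
      1 - (1 - (1 - (p : ℝ)) ^ w) ^ N := by
  set X : (ℕ → Fin N → Bool) → Fin w → Fin N → Bool := fun flips s => flips s with hX
  have hXm : Measurable X := by fun_prop
  set A : Finset (Fin w → Fin N → Bool) := Finset.univ.filter fun a => ∀ j, ∃ s, a s j = true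
  have hset : {flips | (w : ℕ∞) < gameLength flips} = (X ⁻¹' (A : Set (Fin w → Fin N → Bool)))ᶜ := by
    ext flips
    rw [Set.mem_ofPred_eq, lt_gameLength_iff]
    simp [A, hX]
  rw [hset, probReal_compl_eq_one_sub (hXm (Set.toFinite _).measurableSet),
    ← sum_measureReal_preimage_singleton A fun a _ => hXm (measurableSet_singleton a),
    Finset.sum_congr rfl fun a _ => gameMeasure_pattern p a]
  have h := sum_weights_columns (w := w) (p : ℝ) (fun _ => true) (Finset.univ : Finset (Fin N))
  simp only [Finset.mem_univ, forall_true_left, true_and, if_true, Finset.prod_const,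
    Finset.card_univ, Fintype.card_fin] at h
  rw [← h, Finset.sum_filter]

/-! ### Resampling one coordinate of a product measure -/

section Resampling

variable {ι X : Type*} [DecidableEq ι] [MeasurableSpace X] (μ : Measure X) [IsProbabilityMeasure μ]

lemma measurable_update_pair (q : ι) :
    Measurable fun z : (ι → X) × X => Function.update z.1 q z.2 := by
  refine measurable_pi_lambda _ fun i => ?_
  by_cases h : i = q
  · subst h; simpa using measurable_snd
  · simp only [Function.update_of_ne h]; fun_prop

/-- Replacing one coordinate by a fresh independent sample does not change a product law. This
allows conditioning on all other coordinates without conditional expectations. -/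
lemma measurePreserving_update (q : ι) :
    MeasurePreserving (fun z : (ι → X) × X => Function.update z.1 q z.2)
      ((Measure.infinitePi fun _ : ι => μ).prod μ) (Measure.infinitePi fun _ : ι => μ) := by
  refine ⟨measurable_update_pair q, Measure.eq_infinitePi _ fun s t ht => ?_⟩
  rw [Measure.map_apply (measurable_update_pair q)
    (MeasurableSet.pi s.countable_toSet fun i _ => ht i)]
  have hset : (fun z : (ι → X) × X => Function.update z.1 q z.2) ⁻¹' Set.pi s t =
      (Set.pi (s.erase q : Finset ι) t) ×ˢ (if q ∈ s then t q else Set.univ) := by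
    ext ⟨f, x⟩
    simp only [Set.mem_preimage, Set.mem_pi, Set.mem_prod, Finset.mem_coe, Finset.mem_erase]
    constructor
    · intro h
      refine ⟨fun i hi => by simpa [hi.1] using h i hi.2, ?_⟩
      split_ifs with hq
      · simpa using h q hq
      · trivial
    · rintro ⟨h1, h2⟩ i hi
      by_cases hiq : i = q
      · subst hiq; simpa [hi] using h2
      · simpa [hiq] using h1 i ⟨hiq, hi⟩
  rw [hset, Measure.prod_prod, Measure.infinitePi_pi _ fun i _ => ht i]
  split_ifs with hq
  · rw [mul_comm, Finset.mul_prod_erase s (fun i => μ (t i)) hq]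
  · rw [measure_univ, mul_one, Finset.erase_eq_of_notMem hq]

lemma infinitePi_apply_eq_lintegral_update (q : ι) {S : Set (ι → X)} (hS : MeasurableSet S) :
    (Measure.infinitePi fun _ : ι => μ) S =
      ∫⁻ f, μ {x | Function.update f q x ∈ S} ∂(Measure.infinitePi fun _ : ι => μ) := by
  rw [← (measurePreserving_update μ q).measure_preimage hS.nullMeasurableSet,
    Measure.prod_apply (measurable_update_pair q hS)]
  rfl

end Resampling

section Independence

variable {ι X Y R : Type*} [DecidableEq ι] [MeasurableSpace X] [MeasurableSpace Y] [MeasurableSpace R]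
  (μ : Measure X) (κ : Measure Y) (ν : Measure R)
  [IsProbabilityMeasure μ] [IsProbabilityMeasure κ] [IsProbabilityMeasure ν]

/-- An event that does not depend on the second entry of coordinate `q` is independent of it. -/
lemma infinitePi_inter_snd_mem (q : ι) {E : Set (ι → X × Y)} (hE : MeasurableSet E)
    (hinv : ∀ f y, Function.update f q ((f q).1, y) ∈ E ↔ f ∈ E) {D : Set Y}
    (hD : MeasurableSet D) :
    (Measure.infinitePi fun _ : ι => μ.prod κ) (E ∩ {f | (f q).2 ∈ D}) =
      (Measure.infinitePi fun _ : ι => μ.prod κ) E * κ D := by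
  have hD' : MeasurableSet {f : ι → X × Y | (f q).2 ∈ D} :=
    (measurable_snd.comp (measurable_pi_apply q)) hD
  have hmeas : Measurable fun f : ι → X × Y => (μ.prod κ) {x | Function.update f q x ∈ E} :=
    measurable_measure_prodMk_left (measurable_update_pair q hE)
  rw [infinitePi_apply_eq_lintegral_update _ q (hE.inter hD'),
    infinitePi_apply_eq_lintegral_update _ q hE, ← lintegral_mul_const _ hmeas]
  refine lintegral_congr fun f => ?_
  obtain ⟨y₀⟩ : Nonempty Y := ⟨(f q).2⟩
  -- By invariance the section of `E` at coordinate `q` is a cylinder over its first entry, so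
  -- intersecting with `D` gives a rectangle.
  have h1 : {x | Function.update f q x ∈ E} =
      {x : X | Function.update f q (x, y₀) ∈ E} ×ˢ (Set.univ : Set Y) := by
    ext ⟨x, y⟩
    have := hinv (Function.update f q (x, y)) y₀
    simp only [Function.update_self, Function.update_idem] at this
    simp [this]
  have h2 : {x | Function.update f q x ∈ E ∩ {f | (f q).2 ∈ D}} =
      {x : X | Function.update f q (x, y₀) ∈ E} ×ˢ D := by
    ext ⟨x, y⟩
    have := Set.ext_iff.mp h1 (x, y)
    simp only [Set.mem_ofPred_eq, Set.mem_prod, Set.mem_univ, and_true] at this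
    simp [this]
  rw [h1, h2, Measure.prod_prod, Measure.prod_prod, measure_univ, mul_one]

lemma infinitePi_prod_inter_snd_mem (q : ι) {E : Set ((ι → X × Y) × R)} (hE : MeasurableSet E)
    (hinv : ∀ (ω : (ι → X × Y) × R) y,
      (Function.update ω.1 q ((ω.1 q).1, y), ω.2) ∈ E ↔ ω ∈ E)
    {D : Set Y} (hD : MeasurableSet D) :
    ((Measure.infinitePi fun _ : ι => μ.prod κ).prod ν) (E ∩ {ω | (ω.1 q).2 ∈ D}) =
      ((Measure.infinitePi fun _ : ι => μ.prod κ).prod ν) E * κ D := by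
  have hD' : MeasurableSet {ω : (ι → X × Y) × R | (ω.1 q).2 ∈ D} :=
    (measurable_snd.comp ((measurable_pi_apply q).comp measurable_fst)) hD
  rw [Measure.prod_apply_symm (hE.inter hD'), Measure.prod_apply_symm hE,
    ← lintegral_mul_const _ (measurable_measure_prodMk_right hE)]
  refine lintegral_congr fun r => ?_
  exact infinitePi_inter_snd_mem μ κ q (E := (fun f => (f, r)) ⁻¹' E)
    (measurable_prodMk_right hE) (fun f y => hinv (f, r) y) hD

end Independence

/-! ### Uniform digests -/

lemma uniformDigest_prefix {m : ℕ} (a : Fin m → Bool) :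
    uniformDigest {d | ∀ c : Fin m, d c = a c} = (2⁻¹ : ENNReal) ^ m := by
  have hset : {d : Digest | ∀ c : Fin m, d c = a c} =
      Set.pi (Finset.range m : Set ℕ) fun s => {b | ∀ h : s < m, b = a ⟨s, h⟩} := by
    ext d
    simp only [Set.mem_pi, Finset.coe_range, Set.mem_Iio, Set.mem_ofPred_eq, Fin.forall_iff]
    exact ⟨fun h s hs _ => h s hs, fun h s hs => h s hs hs⟩
  rw [hset, uniformDigest,
    Measure.infinitePi_pi _ (fun _ _ => Set.Finite.measurableSet (Set.toFinite _)),
    Finset.prod_range]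
  rw [Finset.prod_eq_pow_card (b := 2⁻¹), Finset.card_univ, Fintype.card_fin]
  intro s _
  have : {b : Bool | ∀ h : (s : ℕ) < m, b = a ⟨s, h⟩} = {a s} := by
    ext b; simp
  rw [this, ← ENNReal.toReal_eq_toReal_iff' (measure_ne_top _ _) (by simp), ← measureReal_def,
    bernoulliMeasure_real_singleton]
  norm_num

/-- A point lies in the cylinder of each of its prefixes, and these have measure `2 ^ (-m)`. -/
lemma uniformDigest_singleton (b : Digest) : uniformDigest {b} = 0 := by
  refine le_antisymm (ge_of_tendsto'
    (ENNReal.tendsto_pow_atTop_nhds_zero_of_lt_one (r := 2⁻¹) (by norm_num)) fun m => ?_) bot_le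
  rw [← uniformDigest_prefix fun c : Fin m => b c]
  refine measure_mono ?_
  rintro d rfl c
  rfl

lemma measurableSet_toLex_lt :
    MeasurableSet {z : Digest × Digest | toLex z.1 < toLex z.2} := by
  -- The index `i` is the first position at which the two strings differ.
  have : {z : Digest × Digest | toLex z.1 < toLex z.2} =
      ⋃ i : ℕ, (⋂ j : ℕ, ⋂ _ : j < i, {z | z.1 j = z.2 j}) ∩
        {z | z.1 i = false ∧ z.2 i = true} := by
    ext z
    simp only [Set.mem_ofPred_eq, Set.mem_iUnion, Set.mem_inter_iff, Set.mem_iInter,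
      ← Bool.lt_iff]
    rfl
  rw [this]
  refine MeasurableSet.iUnion fun i => MeasurableSet.inter ?_ ?_
  · refine MeasurableSet.iInter fun j => MeasurableSet.iInter fun _ => ?_
    exact measurableSet_eq_fun ((measurable_pi_apply j).comp measurable_fst)
      ((measurable_pi_apply j).comp measurable_snd)
  · have h1 : Measurable fun z : Digest × Digest => z.1 i := by fun_prop
    have h2 : Measurable fun z : Digest × Digest => z.2 i := by fun_prop
    exact (h1 (measurableSet_singleton false)).inter (h2 (measurableSet_singleton true))

/-! ### The holder of the smallest hash -/

/-- Player `j` has the smallest digest, and there is no tie. -/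
def IsStrictMin {n : ℕ} (f : Fin n → Digest × Digest) (j : Fin n) : Prop :=
  ∀ j', j' ≠ j → toLex (f j).1 < toLex (f j').1

lemma IsStrictMin.unique {n : ℕ} {f : Fin n → Digest × Digest} {i j : Fin n}
    (hi : IsStrictMin f i) (hj : IsStrictMin f j) : i = j := by
  by_contra h
  exact lt_asymm (hi j (Ne.symm h)) (hj i h)

lemma measurableSet_isStrictMin {n : ℕ} (j : Fin n) :
    MeasurableSet {f : Fin n → Digest × Digest | IsStrictMin f j} := by
  have : {f : Fin n → Digest × Digest | IsStrictMin f j} =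
      ⋂ j' : Fin n, ⋂ _ : j' ≠ j,
        (fun f => ((f j).1, (f j').1)) ⁻¹' {z | toLex z.1 < toLex z.2} := by
    ext f; simp [IsStrictMin]
  rw [this]
  refine MeasurableSet.iInter fun j' => MeasurableSet.iInter fun _ => ?_
  have hm : Measurable fun f : Fin n → Digest × Digest => ((f j).1, (f j').1) := by fun_prop
  exact hm measurableSet_toLex_lt

/-- The law of the oracle at the signatures for one value of the counter. -/
noncomputable abbrev rowMeasure (n : ℕ) : Measure (Fin n → Digest × Digest) :=
  Measure.infinitePi fun _ : Fin n => uniformDigest.prod uniformDigest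

lemma rowMeasure_tie {n : ℕ} {i j : Fin n} (h : i ≠ j) :
    rowMeasure n {f | (f i).1 = (f j).1} = 0 := by
  have hmeas : MeasurableSet {f : Fin n → Digest × Digest | (f i).1 = (f j).1} := by
    have hm : Measurable fun f : Fin n → Digest × Digest => ((f i).1, (f j).1) := by fun_prop
    have : {f : Fin n → Digest × Digest | (f i).1 = (f j).1} =
        ⋂ k : ℕ, {f | (f i).1 k = (f j).1 k} := by
      ext f; simp [funext_iff]
    rw [this]
    refine MeasurableSet.iInter fun k => measurableSet_eq_fun ?_ ?_ <;> fun_prop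
  rw [infinitePi_apply_eq_lintegral_update _ i hmeas]
  refine (lintegral_congr fun f => ?_).trans lintegral_zero
  have : {x | Function.update f i x ∈ {f : Fin n → Digest × Digest | (f i).1 = (f j).1}} =
      {(f j).1} ×ˢ (Set.univ : Set Digest) := by
    ext x
    simp [h.symm]
  rw [this, Measure.prod_prod, uniformDigest_singleton, zero_mul]

/-- The hashes are exchangeable: swapping coordinates `i` and `j` preserves the product law and
exchanges the two events. -/
lemma rowMeasure_isStrictMin_eq {n : ℕ} (i j : Fin n) :
    rowMeasure n {f | IsStrictMin f i} = rowMeasure n {f | IsStrictMin f j} := by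
  have h := Measure.infinitePi_map_piCongrLeft
    (fun _ : Fin n => uniformDigest.prod uniformDigest) (Equiv.swap i j)
  change Measure.map _ (rowMeasure n) = rowMeasure n at h
  conv_lhs => rw [← h]
  rw [Measure.map_apply (MeasurableEquiv.measurable _) (measurableSet_isStrictMin i)]
  congr 1
  ext f
  have hval : ∀ k, (MeasurableEquiv.piCongrLeft (fun _ : Fin n => Digest × Digest)
      (Equiv.swap i j)) f k = f (Equiv.swap i j k) := by
    intro k
    have := MeasurableEquiv.piCongrLeft_apply_apply (Equiv.swap i j)
      (β := fun _ : Fin n => Digest × Digest) f (Equiv.swap i j k)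
    rwa [Equiv.swap_apply_self] at this
  simp only [Set.mem_preimage, Set.mem_ofPred_eq, IsStrictMin, hval, Equiv.swap_apply_left]
  constructor
  · intro H k hk
    have := H (Equiv.swap i j k) (by
      intro h'; apply hk; rw [← Equiv.swap_apply_self i j k, h', Equiv.swap_apply_left])
    rwa [Equiv.swap_apply_self] at this
  · intro H k hk
    refine H _ ?_
    intro h'; apply hk; rw [← Equiv.swap_apply_self i j k, h', Equiv.swap_apply_right]

/-- A minimum always exists, and it fails to be strict only on the null event of a tie. -/
lemma rowMeasure_exists_isStrictMin {n : ℕ} (hn : 0 < n) :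
    rowMeasure n {f | ∃ j, IsStrictMin f j} = 1 := by
  have : Nonempty (Fin n) := ⟨⟨0, hn⟩⟩
  refine (prob_compl_eq_zero_iff₀ ?_).mp ?_
  rotate_left
  · refine measure_mono_null (t := ⋃ i : Fin n, ⋃ j : Fin n, ⋃ _ : i ≠ j,
      {f | (f i).1 = (f j).1}) ?_ ?_
    · intro f hf
      obtain ⟨j, hj⟩ := Finite.exists_min fun j : Fin n => toLex (f j).1
      have : ¬ IsStrictMin f j := fun h => hf ⟨j, h⟩
      unfold IsStrictMin at this
      push Not at this
      obtain ⟨j', hne, hle⟩ := this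
      simp only [Set.mem_iUnion]
      exact ⟨j', j, hne, toLex.injective (le_antisymm (not_lt.mp hle) (hj j'))⟩
    · simp only [measure_iUnion_null_iff]
      exact fun i j h => rowMeasure_tie h
  · refine MeasurableSet.nullMeasurableSet ?_
    have : {f : Fin n → Digest × Digest | ∃ j, IsStrictMin f j} = ⋃ j, {f | IsStrictMin f j} := by
      ext f; simp
    rw [this]
    exact MeasurableSet.iUnion measurableSet_isStrictMin

/-- Some member of `honest` has the smallest digest, without ties. -/
def HonestMin {n : ℕ} (honest : Finset (Fin n)) (f : Fin n → Digest × Digest) : Prop :=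
  ∃ j ∈ honest, IsStrictMin f j

lemma measurableSet_honestMin {n : ℕ} (honest : Finset (Fin n)) :
    MeasurableSet {f | HonestMin honest f} := by
  have : {f | HonestMin honest f} = ⋃ j ∈ honest, {f | IsStrictMin f j} := by
    ext f; simp [HonestMin]
  rw [this]
  exact Finset.measurableSet_biUnion _ fun j _ => measurableSet_isStrictMin j

lemma rowMeasure_real_honestMin_eq_sum {n : ℕ} (honest : Finset (Fin n)) :
    (rowMeasure n).real {f | HonestMin honest f} =
      ∑ j ∈ honest, (rowMeasure n).real {f | IsStrictMin f j} := by
  have : {f | HonestMin honest f} = ⋃ j ∈ honest, {f | IsStrictMin f j} := by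
    ext f; simp [HonestMin]
  rw [this, measureReal_biUnion_finset]
  · intro i _ j _ hij
    exact Set.disjoint_left.mpr fun f hi hj => hij (hi.unique hj)
  · exact fun j _ => measurableSet_isStrictMin j

lemma rowMeasure_real_honestMin {n : ℕ} (hn : 0 < n) (honest : Finset (Fin n)) :
    (rowMeasure n).real {f | HonestMin honest f} = (honest.card : ℝ) / n := by
  let i₀ : Fin n := ⟨0, hn⟩
  have hconst : ∀ s : Finset (Fin n), (rowMeasure n).real {f | HonestMin s f} =
      s.card * (rowMeasure n).real {f | IsStrictMin f i₀} := by
    intro s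
    rw [rowMeasure_real_honestMin_eq_sum, ← nsmul_eq_mul]
    exact Finset.sum_eq_card_nsmul fun j _ =>
      congrArg ENNReal.toReal (rowMeasure_isStrictMin_eq j i₀)
  -- With every player counted the event has probability one, so the common probability of being the
  -- strict minimum is `1 / n`.
  have h1 := hconst Finset.univ
  have h2 : {f | HonestMin (Finset.univ : Finset (Fin n)) f} = {f | ∃ j, IsStrictMin f j} := by
    ext f; simp [HonestMin]
  rw [h2, measureReal_def, rowMeasure_exists_isStrictMin hn, ENNReal.toReal_one,
    Finset.card_univ, Fintype.card_fin] at h1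
  have hn' : (n : ℝ) ≠ 0 := by positivity
  rw [hconst, eq_div_iff hn', mul_assoc, mul_comm _ (n : ℝ), ← h1, mul_one]

/-- In different iterations the events `HonestMin` are independent. -/
lemma oracleMeasure_honestMin_pattern {n : ℕ} (hn : 0 < n) (honest : Finset (Fin n)) {w : ℕ}
    (g : Fin w → Bool) :
    (oracleMeasure n).real
      {H | ∀ s : Fin w, HonestMin honest (fun j => H ((s : ℕ), j)) ↔ g s = true} =
      ∏ s, (if g s = true then (honest.card : ℝ) / n else 1 - (honest.card : ℝ) / n) := by
  set t : ℕ → Set (Fin n → Digest × Digest) := fun s =>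
    {f | ∀ h : s < w, HonestMin honest f ↔ g ⟨s, h⟩ = true} with ht
  have htm : ∀ s, MeasurableSet (t s) := by
    intro s
    by_cases h : s < w
    · have : t s = {f | HonestMin honest f ↔ g ⟨s, h⟩ = true} := by ext f; simp [t, h]
      rw [this]
      cases g ⟨s, h⟩
      · simp only [Bool.false_eq_true, iff_false]
        exact (measurableSet_honestMin honest).compl
      · simpa using measurableSet_honestMin honest
    · have : t s = Set.univ := by ext f; simp [t, h]
      rw [this]; exact MeasurableSet.univ
  have hset : {H : Oracle n | ∀ s : Fin w, HonestMin honest (fun j => H ((s : ℕ), j)) ↔ g s = true}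
      = (MeasurableEquiv.curry ℕ (Fin n) (Digest × Digest)) ⁻¹'
          Set.pi (Finset.range w : Set ℕ) t := by
    ext H
    simp only [Set.mem_preimage, Set.mem_pi, Finset.coe_range, Set.mem_Iio, Set.mem_ofPred_eq,
      Fin.forall_iff, t]
    exact ⟨fun h s hs _ => h s hs, fun h s hs => h s hs hs⟩
  -- Currying presents the oracle as a sequence of independent rows, one for each value of the
  -- counter.
  have hmap := Measure.infinitePi_map_curry
    (fun (_ : ℕ) (_ : Fin n) => uniformDigest.prod uniformDigest)
  rw [measureReal_def, hset, oracleMeasure, ← Measure.map_apply (MeasurableEquiv.measurable _)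
    (MeasurableSet.pi (Finset.countable_toSet _) fun s _ => htm s), hmap,
    Measure.infinitePi_pi _ fun s _ => htm s, ENNReal.toReal_prod, Finset.prod_range]
  refine Finset.prod_congr rfl fun s _ => ?_
  change (rowMeasure n).real (t s) = _
  cases hg : g s
  · have : t s = {f | HonestMin honest f}ᶜ := by
      ext f; simp [t, hg]
    rw [this, probReal_compl_eq_one_sub (measurableSet_honestMin honest),
      rowMeasure_real_honestMin hn]
    simp
  · have : t s = {f | HonestMin honest f} := by
      ext f; simp [t, hg]
    rw [this, rowMeasure_real_honestMin hn]
    simp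

instance (n : ℕ) : IsProbabilityMeasure (oracleMeasure n) := by
  unfold oracleMeasure; infer_instance

/-! ### Counting messages -/

section Counting

variable {n m : ℕ} {α : Type*} {honest : Finset (Fin n)} {inbox : Fin n → Option (Fin m → α)}
  {msg : Fin n → Fin m → α}

lemma le_count (h : ∀ j ∈ honest, inbox j = some (msg j)) (v : α) (c : Fin m) :
    (honest.filter fun j => msg j c = v).card ≤ count inbox v c := by
  refine Finset.card_le_card fun j hj => ?_
  rw [Finset.mem_filter] at hj ⊢
  exact ⟨Finset.mem_univ _, msg j, h j hj.1, hj.2⟩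

lemma count_le (h : ∀ j ∈ honest, inbox j = some (msg j)) (v : α) (c : Fin m) :
    count inbox v c ≤ (honest.filter fun j => msg j c = v).card + honestᶜ.card := by
  refine le_trans (Finset.card_le_card fun j hj => ?_) (Finset.card_union_le _ _)
  rw [Finset.mem_filter] at hj
  obtain ⟨-, msg', h1, h2⟩ := hj
  rw [Finset.mem_union, Finset.mem_filter, Finset.mem_compl]
  by_cases hj : j ∈ honest
  · rw [h j hj, Option.some_inj] at h1
    exact Or.inl ⟨hj, h1 ▸ h2⟩
  · exact Or.inr hj

lemma card_honest_add (honest : Finset (Fin n)) : honest.card + honestᶜ.card = n := by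
  rw [Finset.card_add_card_compl, Fintype.card_fin]

lemma exists_honest_of_count (ht : 3 * honestᶜ.card < n)
    (h : ∀ j ∈ honest, inbox j = some (msg j)) {v : α} {c : Fin m}
    (hc : 2 * n / 3 + 1 ≤ count inbox v c) : ∃ j ∈ honest, msg j c = v := by
  by_contra hne
  push Not at hne
  have := count_le h v c
  rw [Finset.filter_eq_empty_iff.mpr fun j hj => hne j hj, Finset.card_empty] at this
  omega

lemma quorum_of_forall_honest (ht : 3 * honestᶜ.card < n)
    (h : ∀ j ∈ honest, inbox j = some (msg j)) {v : α} {c : Fin m}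
    (hc : ∀ j ∈ honest, msg j c = v) : 2 * n / 3 + 1 ≤ count inbox v c := by
  have := le_count h v c
  rw [Finset.filter_true_of_mem hc] at this
  have := card_honest_add honest
  omega

lemma quorum_unique {v v' : α} {c : Fin m} (h : 2 * n / 3 + 1 ≤ count inbox v c)
    (h' : 2 * n / 3 + 1 ≤ count inbox v' c) : v = v' := by
  by_contra hne
  have hd : Disjoint (Finset.univ.filter fun j => ∃ msg, inbox j = some msg ∧ msg c = v)
      (Finset.univ.filter fun j => ∃ msg, inbox j = some msg ∧ msg c = v') := by
    rw [Finset.disjoint_filter]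
    rintro j - ⟨a, ha, rfl⟩ ⟨b, hb, rfl⟩
    rw [ha, Option.some_inj] at hb
    exact hne (by rw [hb])
  have := Finset.card_union_of_disjoint hd
  have hle := Finset.card_le_univ ((Finset.univ.filter fun j => ∃ msg, inbox j = some msg ∧ msg c = v)
    ∪ (Finset.univ.filter fun j => ∃ msg, inbox j = some msg ∧ msg c = v'))
  rw [Fintype.card_fin] at hle
  unfold count at h h'
  omega

end Counting

lemma deliver_of_mem {n : ℕ} {M : Type*} {honest : Finset (Fin n)} (own : Fin n → Option M)
    (adv : Mail n M) (i : Fin n) {j : Fin n} (hj : j ∈ honest) :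
    deliver honest own adv i j = own j := by
  simp [deliver, hj]

/-! ### Graded consensus -/

lemma gcEcho_eq_some_iff {n m : ℕ} {V : Type*} (inbox : Fin n → Option (Fin m → Option V))
    (c : Fin m) (v : V) :
    gcEcho inbox c = some v ↔ 2 * n / 3 + 1 ≤ count inbox (some v) c := by
  unfold gcEcho
  constructor
  · intro h
    split_ifs at h with hv
    rw [← h]
    exact hv.choose_spec
  · intro h
    have hv : ∃ v : Option V, 2 * n / 3 + 1 ≤ count inbox v c := ⟨_, h⟩
    rw [dif_pos hv]
    exact quorum_unique hv.choose_spec h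

lemma gcOutput_grade_eq_two_iff {n m : ℕ} {V : Type*}
    (inbox : Fin n → Option (Fin m → Option V)) (c : Fin m) :
    (gcOutput inbox c).2 = 2 ↔ ∃ v : V, 2 * n / 3 + 1 ≤ count inbox (some v) c := by
  unfold gcOutput
  split_ifs with h2 h1
  · exact iff_of_true rfl h2
  · exact iff_of_false (by simp) h2
  · exact iff_of_false (by simp) h2

/-! ### Agreement among the honest players -/

section Agreement

variable {n m : ℕ} {honest : Finset (Fin n)}

/-- All honest players hold the bit `b` in component `c`. -/
def AgreeOn (honest : Finset (Fin n)) (S : Fin n → LocalState m) (c : Fin m) (b : Bool) : Prop :=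
  ∀ i ∈ honest, (S i).bits c = b

/-- All honest players hold the same bit in component `c`. -/
def Agree (honest : Finset (Fin n)) (S : Fin n → LocalState m) (c : Fin m) : Prop :=
  ∃ b, AgreeOn honest S c b

/-- A component that is final for some honest player has been agreed upon. -/
def Sound (honest : Finset (Fin n)) (S : Fin n → LocalState m) : Prop :=
  ∀ c, (∃ i ∈ honest, (S i).final c = true) → Agree honest S c

/-- The number of honest players that hold the bit `b` in component `c`. -/
noncomputable def holders (honest : Finset (Fin n)) (S : Fin n → LocalState m) (b : Bool)
    (c : Fin m) : ℕ :=
  (honest.filter fun j => (S j).bits c = b).card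

lemma holders_add (honest : Finset (Fin n)) (S : Fin n → LocalState m) (c : Fin m) :
    holders honest S false c + holders honest S true c = honest.card := by
  unfold holders
  rw [← Finset.card_filter_add_card_filter_not (s := honest) fun j => (S j).bits c = false]
  simp

lemma AgreeOn.holders_eq {S : Fin n → LocalState m} {c : Fin m} {b : Bool}
    (h : AgreeOn honest S c b) : holders honest S b c = honest.card := by
  unfold holders
  rw [Finset.filter_true_of_mem h]

lemma count_bounds (S : Fin n → LocalState m) (adv : Mail n (Fin m → Bool)) (i : Fin n)
    (b : Bool) (c : Fin m) :
    holders honest S b c ≤ count (deliver honest (fun j => some (S j).bits) adv i) b c ∧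
    count (deliver honest (fun j => some (S j).bits) adv i) b c ≤
      holders honest S b c + honestᶜ.card := by
  have h : ∀ j ∈ honest, deliver honest (fun j => some (S j).bits) adv i j = some (S j).bits :=
    fun _ hj => deliver_of_mem _ _ _ hj
  unfold holders
  exact ⟨by convert le_count h b c, by convert count_le h b c⟩

lemma Sound.not_final {S : Fin n → LocalState m} (hS : Sound honest S) {c : Fin m}
    (hc : ¬ Agree honest S c) {i : Fin n} (hi : i ∈ honest) : (S i).final c = false := by
  by_contra h
  exact hc (hS c ⟨i, hi, by simpa using h⟩)

/-! #### Step 1 -/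

variable (ht : 3 * honestᶜ.card < n) {S : Fin n → LocalState m}
include ht

lemma AgreeOn.coinFixed0 {c : Fin m} {b : Bool} (h : AgreeOn honest S c b)
    (adv : Mail n (Fin m → Bool)) : AgreeOn honest (coinFixed0 honest adv S) c b := by
  intro i hi
  have h0 := count_bounds (honest := honest) S adv i false c
  have h1 := count_bounds (honest := honest) S adv i true c
  have hh := h.holders_eq
  have ha := holders_add honest S c
  have hn := card_honest_add honest
  simp only [MBA.coinFixed0]
  cases b <;> split_ifs <;> first | rfl | exact h i hi | (exfalso; omega)

lemma AgreeOn.final_coinFixed0 {c : Fin m} (h : AgreeOn honest S c false)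
    (adv : Mail n (Fin m → Bool)) {i : Fin n} :
    (MBA.coinFixed0 honest adv S i).final c = true := by
  have h0 := count_bounds (honest := honest) S adv i false c
  have hh := h.holders_eq
  have hn := card_honest_add honest
  simp only [MBA.coinFixed0]
  split_ifs <;> first | rfl | (exfalso; omega)

/-- Before agreement no honest player has the component final, so all of them update it. If one sees
more than `2n/3` zeros, then more than `n/3` honest players hold `0`, hence nobody can see more than
`2n/3` ones, and everyone ends with `0`, by quorum or by default. -/
lemma Sound.coinFixed0 (hS : Sound honest S) (adv : Mail n (Fin m → Bool)) :
    Sound honest (coinFixed0 honest adv S) := by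
  rintro c ⟨i, hi, hfin⟩
  by_cases hc : Agree honest S c
  · obtain ⟨b, hb⟩ := hc
    exact ⟨b, hb.coinFixed0 ht adv⟩
  refine ⟨false, fun k hk => ?_⟩
  have hi0 := hS.not_final hc hi
  have hk0 := hS.not_final hc hk
  simp only [MBA.coinFixed0, hi0, Bool.false_eq_true, if_false] at hfin
  have h0 := count_bounds (honest := honest) S adv i false c
  have h1 := count_bounds (honest := honest) S adv k true c
  have ha := holders_add honest S c
  have hn := card_honest_add honest
  simp only [MBA.coinFixed0, hk0, Bool.false_eq_true, if_false]
  split_ifs at hfin ⊢ <;> first | rfl | (exfalso; omega)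

/-! #### Step 2 -/

lemma AgreeOn.coinFixed1 {c : Fin m} {b : Bool} (h : AgreeOn honest S c b)
    (adv : Mail n (Fin m → Bool)) : AgreeOn honest (coinFixed1 honest adv S) c b := by
  intro i hi
  have h0 := count_bounds (honest := honest) S adv i false c
  have h1 := count_bounds (honest := honest) S adv i true c
  have hh := h.holders_eq
  have ha := holders_add honest S c
  have hn := card_honest_add honest
  simp only [MBA.coinFixed1]
  cases b <;> split_ifs <;> first | rfl | exact h i hi | (exfalso; omega)

lemma AgreeOn.final_coinFixed1 {c : Fin m} (h : AgreeOn honest S c true)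
    (adv : Mail n (Fin m → Bool)) {i : Fin n} :
    (MBA.coinFixed1 honest adv S i).final c = true := by
  have h0 := count_bounds (honest := honest) S adv i true c
  have hh := h.holders_eq
  have hn := card_honest_add honest
  simp only [MBA.coinFixed1]
  split_ifs <;> first | rfl | (exfalso; omega)

lemma Sound.coinFixed1 (hS : Sound honest S) (adv : Mail n (Fin m → Bool)) :
    Sound honest (coinFixed1 honest adv S) := by
  rintro c ⟨i, hi, hfin⟩
  by_cases hc : Agree honest S c
  · obtain ⟨b, hb⟩ := hc
    exact ⟨b, hb.coinFixed1 ht adv⟩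
  refine ⟨true, fun k hk => ?_⟩
  have hi0 := hS.not_final hc hi
  have hk0 := hS.not_final hc hk
  simp only [MBA.coinFixed1, hi0, Bool.false_eq_true, if_false] at hfin
  have h0 := count_bounds (honest := honest) S adv i true c
  have h1 := count_bounds (honest := honest) S adv k false c
  have ha := holders_add honest S c
  have hn := card_honest_add honest
  simp only [MBA.coinFixed1, hk0, Bool.false_eq_true, if_false]
  split_ifs at hfin ⊢ <;> first | rfl | (exfalso; omega)

omit ht in
lemma final_coinFixed1_of_final {c : Fin m} (adv : Mail n (Fin m → Bool)) {i : Fin n}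
    (h : (S i).final c = true) : (MBA.coinFixed1 honest adv S i).final c = true := by
  simp [MBA.coinFixed1, h]

/-! #### Step 3 -/

omit ht in
lemma count_bounds_flip (S : Fin n → LocalState m) (adv : Mail n ((Fin m → Bool) × Bool))
    (i : Fin n) (b : Bool) (c : Fin m) :
    holders honest S b c ≤ count (fun j => (deliver honest
      (fun j => some ((S j).bits, if (S j).Halted then false else true)) adv i j).map Prod.fst)
        b c ∧
    count (fun j => (deliver honest
      (fun j => some ((S j).bits, if (S j).Halted then false else true)) adv i j).map Prod.fst)
        b c ≤ holders honest S b c + honestᶜ.card := by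
  have h : ∀ j ∈ honest, (deliver honest
      (fun j => some ((S j).bits, if (S j).Halted then false else true)) adv i j).map Prod.fst =
      some (S j).bits := by
    intro j hj
    rw [deliver_of_mem _ _ _ hj]
    rfl
  unfold holders
  exact ⟨by convert le_count h b c, by convert count_le h b c⟩

lemma AgreeOn.coinFlipped {c : Fin m} {b : Bool} (h : AgreeOn honest S c b) (H : Oracle n)
    (γ : ℕ) (adv : Mail n ((Fin m → Bool) × Bool)) :
    AgreeOn honest (coinFlipped honest H γ adv S) c b := by
  intro i hi
  have h0 := count_bounds_flip (honest := honest) S adv i false c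
  have h1 := count_bounds_flip (honest := honest) S adv i true c
  have hh := h.holders_eq
  have ha := holders_add honest S c
  have hn := card_honest_add honest
  simp only [MBA.coinFlipped]
  cases b <;> split_ifs <;> first | rfl | exact h i hi | (exfalso; omega)

lemma Sound.coinFlipped (hS : Sound honest S) (H : Oracle n) (γ : ℕ)
    (adv : Mail n ((Fin m → Bool) × Bool)) :
    Sound honest (coinFlipped honest H γ adv S) := by
  rintro c ⟨i, hi, hfin⟩
  obtain ⟨b, hb⟩ := hS c ⟨i, hi, hfin⟩
  exact ⟨b, hb.coinFlipped ht H γ adv⟩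

/-- The value of the coin for which the flip leads to agreement. It is determined by the bits of the
honest players before the coin is revealed. -/
noncomputable def goodBit (honest : Finset (Fin n)) (S : Fin n → LocalState m) (c : Fin m) : Bool :=
  if 2 * n < 3 * (holders honest S false c + honestᶜ.card) then false else true

omit ht in
-- The minimum is strict over all players, so the malicious signatures that a receiver does or does
-- not get cannot affect its coin.
lemma coinString_eq {H : Oracle n} {γ : ℕ} {j : Fin n}
    (hj : IsStrictMin (fun j => H (γ, j)) j) {P : Finset (Fin n)} (hP : j ∈ P) :
    coinString H γ P = (H (γ, j)).2 := by
  have hne : P.Nonempty := ⟨j, hP⟩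
  rw [coinString, dif_pos hne]
  have hspec := (P.exists_min_image (fun j => toLex (H (γ, j)).1) hne).choose_spec
  set i := (P.exists_min_image (fun j => toLex (H (γ, j)).1) hne).choose
  have : i = j := by
    by_contra h
    exact absurd (hspec.2 j hP) (not_le.mpr (hj i h))
  rw [this]

lemma agree_coinFlipped_of_goodBit (hS : Sound honest S) {H : Oracle n} {γ : ℕ} {j : Fin n}
    (hj : j ∈ honest) (hmin : IsStrictMin (fun j => H (γ, j)) j) {c : Fin m}
    (hcoin : (H (γ, j)).2 c = goodBit honest S c) (adv : Mail n ((Fin m → Bool) × Bool)) :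
    Agree honest (coinFlipped honest H γ adv S) c := by
  by_cases hc : Agree honest S c
  · obtain ⟨b, hb⟩ := hc
    exact ⟨b, hb.coinFlipped ht H γ adv⟩
  refine ⟨goodBit honest S c, fun i hi => ?_⟩
  -- A halted winner would send no signature, but soundness forbids it to be final in a component
  -- without agreement.
  have hj0 : ¬ (S j).Halted := fun h => by
    have := hS.not_final hc hj
    rw [h c] at this
    cases this
  have h0 := count_bounds_flip (honest := honest) S adv i false c
  have h1 := count_bounds_flip (honest := honest) S adv i true c
  have ha := holders_add honest S c
  have hn := card_honest_add honest
  simp only [MBA.coinFlipped, hS.not_final hc hi, Bool.false_eq_true, if_false]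
  rw [coinString_eq hmin (by
    rw [Finset.mem_filter]
    exact ⟨Finset.mem_univ _, _, by rw [deliver_of_mem _ _ _ hj, if_neg hj0]⟩), hcoin]
  unfold goodBit
  -- A quorum for the other bit is impossible: possible quorums for both bits would need more than
  -- `4n/3` votes, while honest votes plus malicious votes counted twice number fewer than that.
  split_ifs <;> first | rfl | (exfalso; omega)

end Agreement

/-! ### The run -/

section Run

variable {n m : ℕ} {V R : Type*} [MeasurableSpace R] {honest : Finset (Fin n)}

lemma initialState_bits_eq_false_iff (x : Fin n → Fin m → Option V) (A : Adversary honest m V R)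
    (ω : Oracle n × R) (i : Fin n) (c : Fin m) :
    (initialState honest x A ω i).bits c = false ↔
      ∃ v : V, 2 * n / 3 + 1 ≤ count (deliver honest
        (fun j => some (gcEcho (deliver honest (fun j' => some (x j'))
          (A.gc1 (view honest 0 ω)) j))) (A.gc2 (view honest 0 ω)) i) (some v) c := by
  rw [← gcOutput_grade_eq_two_iff]
  simp only [initialState, mgc]
  split_ifs with h <;> simp [h]

lemma agree_initialState (ht : 3 * honestᶜ.card < n) (x : Fin n → Fin m → Option V)
    (A : Adversary honest m V R) (ω : Oracle n × R) {c : Fin m}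
    (hc : c ∉ ambiguous honest x) : Agree honest (initialState honest x A ω) c := by
  have hcard := card_honest_add honest
  obtain ⟨i₀, hi₀⟩ : honest.Nonempty := by
    rw [← Finset.card_pos]; omega
  have hx : ∀ i ∈ honest, x i c = x i₀ c := by
    intro i hi
    by_contra h
    exact hc (by simpa [ambiguous] using ⟨i, hi, i₀, hi₀, h⟩)
  set echo : Fin n → Fin m → Option V := fun j =>
    gcEcho (deliver honest (fun j' => some (x j')) (A.gc1 (view honest 0 ω)) j)
  have hdel : ∀ j, ∀ k ∈ honest, deliver honest (fun j' => some (x j'))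
      (A.gc1 (view honest 0 ω)) j k = some (x k) := fun j k hk => deliver_of_mem _ _ _ hk
  have hdel2 : ∀ j, ∀ k ∈ honest, deliver honest (fun j' => some (echo j'))
      (A.gc2 (view honest 0 ω)) j k = some (echo k) := fun j k hk => deliver_of_mem _ _ _ hk
  cases hv : x i₀ c with
  | some v =>
    refine ⟨false, fun i _ => ?_⟩
    rw [initialState_bits_eq_false_iff]
    refine ⟨v, quorum_of_forall_honest ht (hdel2 i) fun j _ => ?_⟩
    rw [gcEcho_eq_some_iff]
    exact quorum_of_forall_honest ht (hdel j) fun k hk => (hx k hk).trans hv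
  -- A quorum for a proper value would contain an honest echo of it, and that echo in turn an honest
  -- input with this value.
  | none =>
    refine ⟨true, fun i _ => ?_⟩
    rw [← Bool.not_eq_false, initialState_bits_eq_false_iff]
    rintro ⟨v, hcount⟩
    obtain ⟨j, _, hjv⟩ := exists_honest_of_count ht (hdel2 i) hcount
    rw [gcEcho_eq_some_iff] at hjv
    obtain ⟨k, hk, hkv⟩ := exists_honest_of_count ht (hdel j) hjv
    rw [hx k hk, hv] at hkv
    cases hkv

/-- The states of the players in iteration `γ` right before the third step. -/
noncomputable def stateBeforeFlip (x : Fin n → Fin m → Option V) (A : Adversary honest m V R)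
    (ω : Oracle n × R) (γ : ℕ) : Fin n → LocalState m :=
  coinFixed1 honest (A.fixed1 γ (view honest γ ω))
    (coinFixed0 honest (A.fixed0 γ (view honest γ ω)) (stateAfter honest x A ω γ))

lemma stateAfter_succ (x : Fin n → Fin m → Option V) (A : Adversary honest m V R)
    (ω : Oracle n × R) (γ : ℕ) :
    stateAfter honest x A ω (γ + 1) =
      coinFlipped honest ω.1 γ (A.flip γ (view honest (γ + 1) ω)) (stateBeforeFlip x A ω γ) :=
  rfl

variable (ht : 3 * honestᶜ.card < n) (x : Fin n → Fin m → Option V) (A : Adversary honest m V R)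
  (ω : Oracle n × R)
include ht

lemma sound_stateAfter (γ : ℕ) : Sound honest (stateAfter honest x A ω γ) := by
  induction γ with
  | zero =>
    rintro c ⟨i, _, hi⟩
    cases hi
  | succ γ ih => exact ((ih.coinFixed0 ht _).coinFixed1 ht _).coinFlipped ht _ _ _

lemma sound_stateBeforeFlip (γ : ℕ) : Sound honest (stateBeforeFlip x A ω γ) :=
  ((sound_stateAfter ht x A ω γ).coinFixed0 ht _).coinFixed1 ht _

lemma AgreeOn.stateAfter_succ {γ : ℕ} {c : Fin m} {b : Bool}
    (h : AgreeOn honest (stateAfter honest x A ω γ) c b) :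
    AgreeOn honest (stateAfter honest x A ω (γ + 1)) c b :=
  ((h.coinFixed0 ht _).coinFixed1 ht _).coinFlipped ht _ _ _

lemma Agree.stateAfter_mono {γ γ' : ℕ} (hγ : γ ≤ γ') {c : Fin m}
    (h : Agree honest (stateAfter honest x A ω γ) c) :
    Agree honest (stateAfter honest x A ω γ') c := by
  induction γ', hγ using Nat.le_induction with
  | base => exact h
  | succ γ' _ ih =>
    obtain ⟨b, hb⟩ := ih
    exact ⟨b, hb.stateAfter_succ ht x A ω⟩

/-- Agreement on `0` becomes final in step 1 and agreement on `1` in step 2; step 3 leaves the flags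
alone. -/
lemma halted_of_agree {γ : ℕ} (h : ∀ c, Agree honest (stateAfter honest x A ω γ) c) (i : Fin n) :
    (stateAfter honest x A ω (γ + 1) i).Halted := by
  intro c
  obtain ⟨b, hb⟩ := h c
  change (stateBeforeFlip x A ω γ i).final c = true
  cases b
  · exact final_coinFixed1_of_final _ (hb.final_coinFixed0 ht _)
  · exact (hb.coinFixed0 ht _).final_coinFixed1 ht _

lemma exists_ambiguous_not_agree {k : ℕ}
    (h : ((k + 1 : ℕ) : ℕ∞) < iterations honest x A ω) :
    ∃ c ∈ ambiguous honest x, ¬ Agree honest (stateAfter honest x A ω k) c := by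
  by_contra hne
  push Not at hne
  refine not_le.mpr h (sInf_le ⟨k + 1, rfl, fun i _ => halted_of_agree ht x A ω (fun c => ?_) i⟩)
  by_cases hc : c ∈ ambiguous honest x
  · exact hne c hc
  · exact (show Agree honest (stateAfter honest x A ω 0) c from
      agree_initialState ht x A ω hc).stateAfter_mono ht x A ω (Nat.zero_le k)

lemma coin_ne_goodBit_of_not_agree {w : ℕ} {c : Fin m}
    (h : ¬ Agree honest (stateAfter honest x A ω w) c) {γ : ℕ} (hγ : γ < w) {j : Fin n}
    (hj : j ∈ honest) (hmin : IsStrictMin (fun j => ω.1 (γ, j)) j) :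
    (ω.1 (γ, j)).2 c ≠ goodBit honest (stateBeforeFlip x A ω γ) c := by
  intro hcoin
  refine h (Agree.stateAfter_mono ht x A ω hγ ?_)
  exact agree_coinFlipped_of_goodBit ht (sound_stateBeforeFlip ht x A ω γ) hj hmin hcoin _

end Run

/-! ### Maps into discrete spaces -/

/-- Measurability with respect to the discrete σ-algebra on the codomain. -/
def DiscretelyMeasurable {Ω α : Type*} [MeasurableSpace Ω] (f : Ω → α) : Prop :=
  ∀ s : Set α, MeasurableSet (f ⁻¹' s)

namespace DiscretelyMeasurable

variable {Ω α β δ : Type*} [MeasurableSpace Ω]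

lemma of_fibers [Countable α] {f : Ω → α} (h : ∀ a, MeasurableSet {ω | f ω = a}) :
    DiscretelyMeasurable f := by
  intro s
  have : f ⁻¹' s = ⋃ a ∈ s, {ω | f ω = a} := by ext ω; simp
  rw [this]
  exact MeasurableSet.biUnion (Set.to_countable s) fun a _ => h a

lemma fiber {f : Ω → α} (h : DiscretelyMeasurable f) (a : α) : MeasurableSet {ω | f ω = a} :=
  h {a}

lemma comp {f : Ω → α} (h : DiscretelyMeasurable f) (F : α → β) :
    DiscretelyMeasurable fun ω => F (f ω) :=
  fun s => h (F ⁻¹' s)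

lemma const (a : α) : DiscretelyMeasurable fun _ : Ω => a :=
  fun _ => MeasurableSet.const _

lemma prodMk [Countable α] [Countable β] {f : Ω → α} {g : Ω → β} (hf : DiscretelyMeasurable f)
    (hg : DiscretelyMeasurable g) : DiscretelyMeasurable fun ω => (f ω, g ω) := by
  refine of_fibers fun ⟨a, b⟩ => ?_
  have : {ω | (f ω, g ω) = (a, b)} = {ω | f ω = a} ∩ {ω | g ω = b} := by ext ω; simp
  rw [this]
  exact (hf.fiber a).inter (hg.fiber b)

lemma map₂ [Countable α] [Countable β] {f : Ω → α} {g : Ω → β} (F : α → β → δ)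
    (hf : DiscretelyMeasurable f) (hg : DiscretelyMeasurable g) :
    DiscretelyMeasurable fun ω => F (f ω) (g ω) :=
  (hf.prodMk hg).comp fun z => F z.1 z.2

lemma pi {ι : Type*} [Finite ι] [Countable α] {f : Ω → ι → α}
    (h : ∀ i, DiscretelyMeasurable fun ω => f ω i) : DiscretelyMeasurable f := by
  refine of_fibers fun a => ?_
  have : {ω | f ω = a} = ⋂ i, {ω | f ω i = a i} := by ext ω; simp [funext_iff]
  rw [this]
  exact MeasurableSet.iInter fun i => (h i).fiber (a i)

lemma of_measurableSet {p : Ω → Prop} (h : MeasurableSet {ω | p ω}) : DiscretelyMeasurable p := by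
  refine of_fibers fun a => ?_
  by_cases ha : a
  · simpa [ha] using h
  · simp only [ha, eq_iff_iff, iff_false]
    exact h.compl

lemma of_measurable [MeasurableSpace α] [DiscreteMeasurableSpace α] {f : Ω → α}
    (h : Measurable f) : DiscretelyMeasurable f :=
  fun s => h (MeasurableSet.of_discrete (s := s))

end DiscretelyMeasurable

/-! ### Measurability of the run -/

instance (m : ℕ) : Finite (LocalState m) :=
  Finite.of_injective (fun s : LocalState m => (s.bits, s.final)) fun s t h => by
    cases s; cases t; simpa using h

/-- Only finitely many yes-or-no events enter the count, so the message alphabet may be uncountable.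
-/
lemma measurableSet_le_count {Ω α : Type*} [MeasurableSpace Ω] {n m : ℕ}
    {inbox : Ω → Fin n → Option (Fin m → α)} {v : α} {c : Fin m} (K : ℕ)
    (h : ∀ j, MeasurableSet {ω | ∃ msg, inbox ω j = some msg ∧ msg c = v}) :
    MeasurableSet {ω | K ≤ count (inbox ω) v c} := by
  have h1 : DiscretelyMeasurable fun ω (j : Fin n) => ∃ msg, inbox ω j = some msg ∧ msg c = v :=
    DiscretelyMeasurable.pi fun j => DiscretelyMeasurable.of_measurableSet (h j)
  refine (congrArg MeasurableSet ?_).mp (h1 {p | K ≤ (Finset.univ.filter p).card})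
  ext ω
  simp only [Set.mem_preimage, Set.mem_ofPred_eq, count]
  congr!

section Run

variable {n m : ℕ} {V R : Type*} [MeasurableSpace R] {honest : Finset (Fin n)}

lemma measurable_view (γ : ℕ) : Measurable (view honest (R := R) γ) := by
  unfold view
  fun_prop

lemma discretelyMeasurable_of_view {γ : ℕ} {β : Type*} {f : View honest R γ → β}
    (hf : @Measurable _ _ _ ⊤ f) :
    DiscretelyMeasurable fun ω : Oracle n × R => f (view honest γ ω) := by
  intro s
  exact measurable_view γ (hf (t := s) trivial)

lemma discretelyMeasurable_initialState (ht : 3 * honestᶜ.card < n)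
    (x : Fin n → Fin m → Option V) (A : Adversary honest m V R) :
    DiscretelyMeasurable fun ω : Oracle n × R => initialState honest x A ω := by
  have hecho : ∀ (j : Fin n) (c : Fin m) (v : V), MeasurableSet {ω : Oracle n × R |
      gcEcho (deliver honest (fun j' => some (x j')) (A.gc1 (view honest 0 ω)) j) c = some v} := by
    intro j c v
    simp only [gcEcho_eq_some_iff]
    refine measurableSet_le_count _ fun k => ?_
    by_cases hk : k ∈ honest
    · simp only [deliver, hk, if_true]
      exact MeasurableSet.const _
    · simp only [deliver, hk, if_false]
      exact discretelyMeasurable_of_view A.measurable_gc1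
        {M | ∃ msg, M k j = some msg ∧ msg c = some v}
  have hbits : ∀ (i : Fin n) (c : Fin m), MeasurableSet {ω : Oracle n × R |
      (initialState honest x A ω i).bits c = false} := by
    intro i c
    simp only [initialState_bits_eq_false_iff]
    have hq : ∀ v : V, MeasurableSet {ω : Oracle n × R | 2 * n / 3 + 1 ≤ count (deliver honest
        (fun j => some (gcEcho (deliver honest (fun j' => some (x j'))
          (A.gc1 (view honest 0 ω)) j))) (A.gc2 (view honest 0 ω)) i) (some v) c} := by
      intro v
      refine measurableSet_le_count _ fun k => ?_
      by_cases hk : k ∈ honest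
      · simp only [deliver, hk, if_true, Option.some_inj, exists_eq_left']
        exact hecho k c v
      · simp only [deliver, hk, if_false]
        exact discretelyMeasurable_of_view A.measurable_gc2
          {M | ∃ msg, M k i = some msg ∧ msg c = some v}
    -- `V` may be uncountable, but a value that reaches a quorum must be the input of some player,
    -- so a finite union suffices.
    have hset : {ω : Oracle n × R | ∃ v : V, 2 * n / 3 + 1 ≤ count (deliver honest
        (fun j => some (gcEcho (deliver honest (fun j' => some (x j'))
          (A.gc1 (view honest 0 ω)) j))) (A.gc2 (view honest 0 ω)) i) (some v) c} =
        ⋃ v ∈ {v : V | ∃ k, x k c = some v}, {ω : Oracle n × R | 2 * n / 3 + 1 ≤ count (deliver honest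
        (fun j => some (gcEcho (deliver honest (fun j' => some (x j'))
          (A.gc1 (view honest 0 ω)) j))) (A.gc2 (view honest 0 ω)) i) (some v) c} := by
      ext ω
      simp only [Set.mem_ofPred_eq, Set.mem_iUnion, exists_prop]
      refine exists_congr fun v => ⟨fun h => ⟨?_, h⟩, fun h => h.2⟩
      obtain ⟨j, _, hj⟩ := exists_honest_of_count ht
        (fun k hk => deliver_of_mem (fun j => some (gcEcho (deliver honest (fun j' => some (x j'))
          (A.gc1 (view honest 0 ω)) j))) _ _ hk) h
      rw [gcEcho_eq_some_iff] at hj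
      obtain ⟨k, _, hk⟩ := exists_honest_of_count ht
        (fun k hk => deliver_of_mem (fun j' => some (x j')) _ _ hk) hj
      exact ⟨k, hk⟩
    rw [hset]
    refine MeasurableSet.biUnion (Set.Finite.countable ?_) fun v _ => hq v
    refine Set.Finite.of_finite_image (f := some) (Set.Finite.subset
      (Set.finite_range fun k => x k c) ?_) (Option.some_injective V).injOn
    rintro _ ⟨v, ⟨k, hk⟩, rfl⟩
    exact ⟨k, hk⟩
  have hb : DiscretelyMeasurable fun (ω : Oracle n × R) (i : Fin n) (c : Fin m) =>
      (initialState honest x A ω i).bits c := by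
    refine DiscretelyMeasurable.pi fun i => DiscretelyMeasurable.pi fun c =>
      DiscretelyMeasurable.of_fibers fun b => ?_
    cases b
    · exact hbits i c
    · simp only [← Bool.not_eq_false]
      exact (hbits i c).compl
  exact hb.comp fun B i => ({ bits := B i, final := fun _ => false } : LocalState m)

lemma measurableSet_toLex_le (q q' : ℕ × Fin n) :
    MeasurableSet {ω : Oracle n × R | toLex (ω.1 q).1 ≤ toLex (ω.1 q').1} := by
  simp only [← not_lt]
  have hm : Measurable fun ω : Oracle n × R => ((ω.1 q').1, (ω.1 q).1) := by fun_prop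
  exact (hm measurableSet_toLex_lt).compl

/-- The chosen minimizer depends only on the table of comparisons between first hashes. This finite
description serves both measurability and the dependence on a single row of the oracle. -/
lemma exists_coinString_eq (γ : ℕ) {P : Finset (Fin n)} (hP : P.Nonempty) :
    ∃ sel : (Fin n → Fin n → Prop) → Fin n, ∀ H : Oracle n, coinString H γ P =
      (H (γ, sel fun i j => toLex (H (γ, i)).1 ≤ toLex (H (γ, j)).1)).2 := by
  refine ⟨fun r => if h : ∃ i ∈ P, ∀ j ∈ P, r i j then h.choose else hP.choose, fun H => ?_⟩
  rw [coinString, dif_pos hP]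
  have h : ∃ i ∈ P, ∀ j ∈ P, toLex (H (γ, i)).1 ≤ toLex (H (γ, j)).1 :=
    P.exists_min_image (fun j => toLex (H (γ, j)).1) hP
  simp only [dif_pos h]

lemma discretelyMeasurable_coinString (γ : ℕ) (P : Finset (Fin n)) (k : ℕ) :
    DiscretelyMeasurable fun ω : Oracle n × R => coinString ω.1 γ P k := by
  by_cases hP : P.Nonempty
  · obtain ⟨sel, hsel⟩ := exists_coinString_eq γ hP
    have hs : DiscretelyMeasurable fun ω : Oracle n × R =>
        sel fun i j => toLex (ω.1 (γ, i)).1 ≤ toLex (ω.1 (γ, j)).1 :=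
      (DiscretelyMeasurable.pi fun i => DiscretelyMeasurable.pi fun j =>
        DiscretelyMeasurable.of_measurableSet (measurableSet_toLex_le (γ, i) (γ, j))).comp sel
    have hb : DiscretelyMeasurable fun (ω : Oracle n × R) (j : Fin n) => (ω.1 (γ, j)).2 k :=
      DiscretelyMeasurable.pi fun j => DiscretelyMeasurable.of_measurable (by fun_prop)
    simp only [hsel]
    exact DiscretelyMeasurable.map₂ (fun j b => b j) hs hb
  · simp only [coinString, dif_neg hP]
    exact DiscretelyMeasurable.const _

/-- The third step, as a function of the possible coins. -/
lemma exists_coinFlipped_eq (honest : Finset (Fin n)) (m : ℕ) :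
    ∃ F : (Finset (Fin n) → Fin m → Bool) → Mail n ((Fin m → Bool) × Bool) →
      (Fin n → LocalState m) → Fin n → LocalState m, ∀ (H : Oracle n) (γ : ℕ) adv S,
      coinFlipped honest H γ adv S = F (fun P c => coinString H γ P c) adv S :=
  ⟨fun K adv S i =>
    let received := deliver honest
      (fun j => some ((S j).bits, if (S j).Halted then false else true)) adv i
    let inbox : Fin n → Option (Fin m → Bool) := fun j => (received j).map Prod.fst
    let P : Finset (Fin n) := Finset.univ.filter fun j => ∃ b, received j = some (b, true)
    { bits := fun c =>
        if (S i).final c = true then (S i).bits c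
        else if 2 * n < 3 * count inbox false c then false
        else if 2 * n < 3 * count inbox true c then true
        else K P c
      final := (S i).final }, fun _ _ _ _ => rfl⟩

variable (x : Fin n → Fin m → Option V) (A : Adversary honest m V R)

lemma discretelyMeasurable_stateBeforeFlip_of_stateAfter {γ : ℕ}
    (h : DiscretelyMeasurable fun ω : Oracle n × R => stateAfter honest x A ω γ) :
    DiscretelyMeasurable fun ω : Oracle n × R => stateBeforeFlip x A ω γ :=
  DiscretelyMeasurable.map₂ (coinFixed1 honest)
    (discretelyMeasurable_of_view (A.measurable_fixed1 γ))
    (DiscretelyMeasurable.map₂ (coinFixed0 honest)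
      (discretelyMeasurable_of_view (A.measurable_fixed0 γ)) h)

lemma discretelyMeasurable_stateAfter (ht : 3 * honestᶜ.card < n) (γ : ℕ) :
    DiscretelyMeasurable fun ω : Oracle n × R => stateAfter honest x A ω γ := by
  induction γ with
  | zero => exact discretelyMeasurable_initialState ht x A
  | succ γ ih =>
    obtain ⟨F, hF⟩ := exists_coinFlipped_eq honest m
    simp only [stateAfter_succ, hF]
    refine DiscretelyMeasurable.map₂ (fun z S => F z.1 z.2 S)
      (DiscretelyMeasurable.prodMk (DiscretelyMeasurable.pi fun P => DiscretelyMeasurable.pi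
        fun c : Fin m => discretelyMeasurable_coinString γ P c)
        (discretelyMeasurable_of_view (A.measurable_flip γ)))
      (discretelyMeasurable_stateBeforeFlip_of_stateAfter x A ih)

lemma discretelyMeasurable_stateBeforeFlip (ht : 3 * honestᶜ.card < n) (γ : ℕ) :
    DiscretelyMeasurable fun ω : Oracle n × R => stateBeforeFlip x A ω γ :=
  discretelyMeasurable_stateBeforeFlip_of_stateAfter x A (discretelyMeasurable_stateAfter x A ht γ)

/-! ### The run depends only on what has been revealed -/

omit [MeasurableSpace R] in
lemma view_eq_iff {γ : ℕ} {ω ω' : Oracle n × R} :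
    view honest γ ω = view honest γ ω' ↔
      (∀ q : ℕ × Fin n, q.2 ∉ honest ∨ q.1 < γ → ω.1 q = ω'.1 q) ∧ ω.2 = ω'.2 := by
  simp [view, funext_iff]

omit [MeasurableSpace R] in
lemma view_eq_mono {γ γ' : ℕ} (hγ : γ ≤ γ') {ω ω' : Oracle n × R}
    (h : view honest γ' ω = view honest γ' ω') : view honest γ ω = view honest γ ω' := by
  rw [view_eq_iff] at h ⊢
  exact ⟨fun q hq => h.1 q (hq.imp_right fun hq => hq.trans_le hγ), h.2⟩

lemma coinString_congr {γ : ℕ} {H H' : Oracle n} (h : ∀ j, H (γ, j) = H' (γ, j))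
    (P : Finset (Fin n)) : coinString H γ P = coinString H' γ P := by
  by_cases hP : P.Nonempty
  · obtain ⟨sel, hsel⟩ := exists_coinString_eq γ hP
    simp only [hsel, h]
  · simp only [coinString, dif_neg hP]

/-- Iteration `γ` consults only row `γ` of the oracle and views up to `γ + 1`, all contained in the
view at `γ + 1`. -/
lemma stateAfter_congr {γ : ℕ} {ω ω' : Oracle n × R} (h : view honest γ ω = view honest γ ω') :
    stateAfter honest x A ω γ = stateAfter honest x A ω' γ := by
  induction γ with
  | zero => simp only [stateAfter, initialState, h]
  | succ γ ih =>
    obtain ⟨F, hF⟩ := exists_coinFlipped_eq honest m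
    have h' := view_eq_mono (Nat.le_succ γ) h
    have hrow : ∀ j, ω.1 (γ, j) = ω'.1 (γ, j) := fun j =>
      (view_eq_iff.mp h).1 (γ, j) (Or.inr (Nat.lt_succ_self γ))
    simp only [stateAfter_succ, hF, stateBeforeFlip, ih h', h, h', coinString_congr hrow]

lemma stateBeforeFlip_congr {γ : ℕ} {ω ω' : Oracle n × R}
    (h : view honest γ ω = view honest γ ω') :
    stateBeforeFlip x A ω γ = stateBeforeFlip x A ω' γ := by
  simp only [stateBeforeFlip, h, stateAfter_congr x A h]

end Run

lemma measure_eq_sum_fibers {Ω α : Type*} [MeasurableSpace Ω] [Fintype α]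
    (μ : Measure Ω) {Z : Ω → α} (hZ : DiscretelyMeasurable Z) (S : Set Ω) :
    μ S = ∑ z, μ (S ∩ {ω | Z ω = z}) := by
  have h := sum_measure_preimage_singleton (μ := μ.restrict S) (Finset.univ : Finset α) (f := Z)
    fun z _ => hZ {z}
  rw [Finset.coe_univ, Set.preimage_univ, Measure.restrict_apply_univ] at h
  rw [← h]
  refine Finset.sum_congr rfl fun z _ => ?_
  rw [Measure.restrict_apply (hZ {z}), Set.inter_comm]
  rfl

/-! ### The coins -/

/-- A member of `honest` with property `p`, or `i₀` if there is none. -/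
noncomputable def pick {n : ℕ} (honest : Finset (Fin n)) (i₀ : Fin n) (p : Fin n → Prop) : Fin n :=
  if h : ∃ j ∈ honest, p j then h.choose else i₀

/-- The honest player with the smallest digest, or `i₀` if there is none. -/
noncomputable def winner {n : ℕ} (honest : Finset (Fin n)) (i₀ : Fin n)
    (f : Fin n → Digest × Digest) : Fin n :=
  pick honest i₀ (IsStrictMin f)

lemma winner_mem {n : ℕ} {honest : Finset (Fin n)} {i₀ : Fin n} (hi₀ : i₀ ∈ honest)
    (f : Fin n → Digest × Digest) : winner honest i₀ f ∈ honest := by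
  unfold winner pick
  split_ifs with h
  · exact h.choose_spec.1
  -- The honest default keeps the winner honest in every case, so its coin is fair without
  -- conditioning on `HonestMin`.
  · exact hi₀

lemma isStrictMin_winner {n : ℕ} {honest : Finset (Fin n)} (i₀ : Fin n)
    {f : Fin n → Digest × Digest} (h : HonestMin honest f) :
    IsStrictMin f (winner honest i₀ f) := by
  unfold winner pick
  have h' : ∃ j ∈ honest, IsStrictMin f j := h
  rw [dif_pos h']
  exact h'.choose_spec.2

lemma isStrictMin_congr {n : ℕ} {f f' : Fin n → Digest × Digest} (h : ∀ j, (f j).1 = (f' j).1) :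
    IsStrictMin f = IsStrictMin f' := by
  funext j
  simp only [IsStrictMin, h]

lemma honestMin_congr {n : ℕ} (honest : Finset (Fin n)) {f f' : Fin n → Digest × Digest}
    (h : ∀ j, (f j).1 = (f' j).1) : HonestMin honest f = HonestMin honest f' := by
  simp only [HonestMin, isStrictMin_congr h]

lemma winner_congr {n : ℕ} (honest : Finset (Fin n)) (i₀ : Fin n)
    {f f' : Fin n → Digest × Digest} (h : ∀ j, (f j).1 = (f' j).1) :
    winner honest i₀ f = winner honest i₀ f' := by
  rw [winner, winner, isStrictMin_congr h]

lemma discretelyMeasurable_winner {n : ℕ} (honest : Finset (Fin n)) (i₀ : Fin n) :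
    DiscretelyMeasurable (winner honest i₀) := by
  have h : DiscretelyMeasurable fun (f : Fin n → Digest × Digest) (j : Fin n) =>
      IsStrictMin f j :=
    DiscretelyMeasurable.pi fun j => DiscretelyMeasurable.of_measurableSet
      (measurableSet_isStrictMin j)
  exact h.comp (pick honest i₀)

lemma DiscretelyMeasurable.comp_measurable {Ω Ω' α : Type*} [MeasurableSpace Ω]
    [MeasurableSpace Ω'] {f : Ω' → α} (hf : DiscretelyMeasurable f) {g : Ω → Ω'}
    (hg : Measurable g) : DiscretelyMeasurable fun ω => f (g ω) :=
  fun s => hg (hf s)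

/-! ### Fairness and independence of the coins, by resampling second hashes. -/

section Run

variable {n m : ℕ} {V R : Type*} [MeasurableSpace R] {honest : Finset (Fin n)}

/-- The oracle at the signatures for the counter `γ`. -/
def row (ω : Oracle n × R) (γ : ℕ) : Fin n → Digest × Digest := fun j => ω.1 (γ, j)

lemma measurable_row (γ : ℕ) : Measurable fun ω : Oracle n × R => row ω γ := by
  unfold row
  fun_prop

variable (i₀ : Fin n) (x : Fin n → Fin m → Option V) (A : Adversary honest m V R)

/-- Whether in iteration `γ` the coin for component `c` of the honest player with the smallest
digest leads to agreement. -/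
noncomputable def coinRight (ω : Oracle n × R) (γ : ℕ) (c : Fin m) : Bool :=
  (row ω γ (winner honest i₀ (row ω γ))).2 c == goodBit honest (stateBeforeFlip x A ω γ) c

/-- Replace the second hash of player `j` for the counter `γ`. -/
noncomputable def resample (ω : Oracle n × R) (q : ℕ × Fin n) (y : Digest) : Oracle n × R :=
  (Function.update ω.1 q ((ω.1 q).1, y), ω.2)

omit [MeasurableSpace R] in
lemma row_resample_fst (ω : Oracle n × R) (q : ℕ × Fin n) (y : Digest) (γ : ℕ) (j : Fin n) :
    (row (resample ω q y) γ j).1 = (row ω γ j).1 := by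
  by_cases h : (γ, j) = q
  · subst h; simp [row, resample]
  · simp [row, resample, h]

omit [MeasurableSpace R] in
lemma row_resample_of_ne (ω : Oracle n × R) {q : ℕ × Fin n} (y : Digest) {γ : ℕ} (h : γ ≠ q.1) :
    row (resample ω q y) γ = row ω γ := by
  funext j
  have : (γ, j) ≠ q := fun hq => h (congrArg Prod.fst hq)
  simp [row, resample, this]

omit [MeasurableSpace R] in
lemma view_resample (ω : Oracle n × R) {q : ℕ × Fin n} (hq : q.2 ∈ honest) (y : Digest) {γ : ℕ}
    (h : γ ≤ q.1) : view honest γ (resample ω q y) = view honest γ ω := by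
  rw [view_eq_iff]
  refine ⟨fun q' hq' => ?_, rfl⟩
  have : q' ≠ q := by
    rintro rfl
    rcases hq' with h' | h'
    · exact h' hq
    · omega
  simp [resample, this]

lemma discretelyMeasurable_coinRight (ht : 3 * honestᶜ.card < n) (γ : ℕ) (c : Fin m) :
    DiscretelyMeasurable fun ω : Oracle n × R => coinRight i₀ x A ω γ c := by
  have h1 : DiscretelyMeasurable fun (ω : Oracle n × R) (j : Fin n) => (row ω γ j).2 (c : ℕ) :=
    DiscretelyMeasurable.pi fun j => DiscretelyMeasurable.of_measurable
      (by unfold row; fun_prop)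
  have h2 := (discretelyMeasurable_winner honest i₀).comp_measurable
    (measurable_row (n := n) (R := R) γ)
  have h3 := discretelyMeasurable_stateBeforeFlip x A ht γ
  exact DiscretelyMeasurable.map₂ (fun z S => z.1 z.2 == goodBit honest S c) (h1.prodMk h2) h3

variable (ν : Measure R) [IsProbabilityMeasure ν]

lemma prod_inter_resample (q : ℕ × Fin n) {E : Set (Oracle n × R)} (hE : MeasurableSet E)
    (hinv : ∀ ω y, resample ω q y ∈ E ↔ ω ∈ E) {D : Set Digest} (hD : MeasurableSet D) :
    ((oracleMeasure n).prod ν) (E ∩ {ω | (ω.1 q).2 ∈ D}) =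
      ((oracleMeasure n).prod ν) E * uniformDigest D :=
  infinitePi_prod_inter_snd_mem uniformDigest uniformDigest ν q hE
    hinv hD

variable {i₀}

/-- One round of coins: given the past and all first hashes, the coins are fair. -/
lemma prod_inter_coinRight (ht : 3 * honestᶜ.card < n) (hi₀ : i₀ ∈ honest) (γ : ℕ)
    {E : Set (Oracle n × R)} (hE : MeasurableSet E)
    (hinv : ∀ ω, ∀ j ∈ honest, ∀ y, resample ω (γ, j) y ∈ E ↔ ω ∈ E) (a : Fin m → Bool) :
    ((oracleMeasure n).prod ν) (E ∩ {ω | coinRight i₀ x A ω γ = a}) =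
      ((oracleMeasure n).prod ν) E * 2⁻¹ ^ m := by
  -- On a fibre of `Z` both the winner and the right bits are frozen, so the event concerns the
  -- second hash at one fixed oracle entry. The fibre itself ignores that entry, since the winner
  -- depends on first hashes only and the right bits on the view at `γ`.
  set Z : Oracle n × R → Fin n × (Fin m → Bool) := fun ω =>
    (winner honest i₀ (row ω γ), goodBit honest (stateBeforeFlip x A ω γ)) with hZ
  have hZm : DiscretelyMeasurable Z :=
    ((discretelyMeasurable_winner honest i₀).comp_measurable (measurable_row γ)).prodMk
      ((discretelyMeasurable_stateBeforeFlip x A ht γ).comp fun S => goodBit honest S)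
  rw [measure_eq_sum_fibers _ hZm, measure_eq_sum_fibers _ hZm E, Finset.sum_mul]
  refine Finset.sum_congr rfl ?_
  rintro ⟨j, b⟩ -
  by_cases hj : j ∈ honest
  · have hset : E ∩ {ω | coinRight i₀ x A ω γ = a} ∩ {ω | Z ω = (j, b)} =
        E ∩ {ω | Z ω = (j, b)} ∩ {ω | (ω.1 (γ, j)).2 ∈
          {d : Digest | ∀ c : Fin m, d c = (if a c = true then b c else !b c)}} := by
      ext ω
      simp only [Set.mem_inter_iff, Set.mem_ofPred_eq, hZ, Prod.mk.injEq]
      constructor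
      · rintro ⟨⟨h1, rfl⟩, rfl, rfl⟩
        refine ⟨⟨h1, rfl, rfl⟩, fun c => ?_⟩
        have key : ∀ u v : Bool, v = if (v == u) = true then u else !u := by decide
        exact key _ _
      · rintro ⟨⟨h1, rfl, rfl⟩, h⟩
        refine ⟨⟨h1, ?_⟩, rfl, rfl⟩
        funext c
        have hc := h c
        simp only [coinRight, row] at hc ⊢
        rw [hc]
        generalize goodBit honest (stateBeforeFlip x A ω γ) c = u
        cases a c <;> cases u <;> rfl
    rw [hset, prod_inter_resample ν (γ, j) (hE.inter (hZm.fiber _)), uniformDigest_prefix]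
    · intro ω y
      have hZ' : Z (resample ω (γ, j) y) = Z ω := by
        simp only [hZ]
        rw [winner_congr honest i₀ (row_resample_fst ω (γ, j) y γ),
          stateBeforeFlip_congr x A (view_resample ω hj y le_rfl)]
      simp only [Set.mem_inter_iff, Set.mem_ofPred_eq, hZ', hinv ω j hj y]
    · have : {d : Digest | ∀ c : Fin m, d c = (if a c = true then b c else !b c)} =
          ⋂ c : Fin m, {d : Digest | d c = (if a c = true then b c else !b c)} := by
        ext d; simp
      rw [this]
      exact MeasurableSet.iInter fun c => (measurable_pi_apply _) (measurableSet_singleton _)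
  · have hempty : ∀ T : Set (Oracle n × R), T ∩ {ω | Z ω = (j, b)} = ∅ := by
      intro T
      ext ω
      simp only [Set.mem_inter_iff, Set.mem_ofPred_eq, Set.mem_empty_iff_false, iff_false, hZ,
        Prod.mk.injEq, not_and]
      rintro _ rfl
      exact absurd (winner_mem hi₀ _) hj
    rw [hempty, hempty, measure_empty, zero_mul]

/-- An honest hash with a later counter is outside the view at `γ` and outside row `γ`. -/
lemma coinRight_resample (ω : Oracle n × R) {γ γ' : ℕ} (h : γ < γ') {j : Fin n} (hj : j ∈ honest)
    (y : Digest) : coinRight i₀ x A (resample ω (γ', j) y) γ = coinRight i₀ x A ω γ := by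
  funext c
  simp only [coinRight]
  rw [row_resample_of_ne ω (q := (γ', j)) y h.ne,
    stateBeforeFlip_congr x A (view_resample ω (q := (γ', j)) hj y h.le)]

/-- The coins of the first `w` iterations are fair, independent, and independent of the first
hashes. -/
lemma prod_inter_coinRight_pattern (ht : 3 * honestᶜ.card < n) (hi₀ : i₀ ∈ honest)
    {E : Set (Oracle n × R)} (hE : MeasurableSet E)
    (hinv : ∀ ω q y, resample ω q y ∈ E ↔ ω ∈ E) (w : ℕ) (a : ℕ → Fin m → Bool) :
    ((oracleMeasure n).prod ν) (E ∩ {ω | ∀ γ < w, coinRight i₀ x A ω γ = a γ}) =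
      ((oracleMeasure n).prod ν) E * (2⁻¹ ^ m) ^ w := by
  induction w with
  | zero => simp
  | succ w ih =>
    have hset : E ∩ {ω | ∀ γ < w + 1, coinRight i₀ x A ω γ = a γ} =
        E ∩ {ω | ∀ γ < w, coinRight i₀ x A ω γ = a γ} ∩ {ω | coinRight i₀ x A ω w = a w} := by
      ext ω
      simp only [Set.mem_inter_iff, Set.mem_ofPred_eq, Nat.forall_lt_succ_right, and_assoc]
    rw [hset, prod_inter_coinRight x A ν ht hi₀ w _ _ (a w), ih, pow_succ, mul_assoc]
    · refine hE.inter ?_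
      have : {ω | ∀ γ < w, coinRight i₀ x A ω γ = a γ} =
          ⋂ γ : ℕ, ⋂ _ : γ < w, {ω | coinRight i₀ x A ω γ = a γ} := by ext ω; simp
      rw [this]
      refine MeasurableSet.iInter fun γ => MeasurableSet.iInter fun _ => ?_
      exact (DiscretelyMeasurable.pi
        fun c => discretelyMeasurable_coinRight i₀ x A ht γ c).fiber (a γ)
    · intro ω j hj y
      simp only [Set.mem_inter_iff, Set.mem_ofPred_eq, hinv]
      refine and_congr_right fun _ => forall₂_congr fun γ hγ => ?_
      rw [coinRight_resample x A ω hγ hj y]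

variable (i₀)

/-- For which of the first `w` iterations an honest player has the smallest digest, and which coins
of the first `w` iterations lead to agreement. -/
noncomputable def coinPattern (w : ℕ) (ω : Oracle n × R) :
    (Fin w → Bool) × (Fin w → Fin m → Bool) :=
  (fun s => decide (HonestMin honest (row ω s)), fun s => coinRight i₀ x A ω s)

lemma discretelyMeasurable_coinPattern (ht : 3 * honestᶜ.card < n) (w : ℕ) :
    DiscretelyMeasurable (coinPattern i₀ x A w) := by
  refine DiscretelyMeasurable.prodMk (DiscretelyMeasurable.pi fun s => ?_)
    (DiscretelyMeasurable.pi fun s => DiscretelyMeasurable.pi fun c =>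
      discretelyMeasurable_coinRight i₀ x A ht s c)
  exact (DiscretelyMeasurable.of_measurableSet
    (measurable_row (n := n) (R := R) s (measurableSet_honestMin honest))).comp
      fun p => decide p

variable {i₀}

lemma coinPattern_law (ht : 3 * honestᶜ.card < n) (hi₀ : i₀ ∈ honest) {w : ℕ}
    (g : Fin w → Bool) (a : Fin w → Fin m → Bool) :
    ((oracleMeasure n).prod ν).real (coinPattern i₀ x A w ⁻¹' {(g, a)}) =
      (∏ s, (if g s = true then (honest.card : ℝ) / n else 1 - (honest.card : ℝ) / n)) *
        ∏ s, ∏ c, (if a s c = true then 1 / 2 else 1 - 1 / 2) := by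
  set G : Set (Oracle n) :=
    {H | ∀ s : Fin w, HonestMin honest (fun j => H ((s : ℕ), j)) ↔ g s = true} with hG
  have hrow : ∀ s : ℕ, Measurable fun (H : Oracle n) (j : Fin n) => H (s, j) := by
    intro s; fun_prop
  have hGm : MeasurableSet G := by
    have : G = ⋂ s : Fin w, {H : Oracle n |
        HonestMin honest (fun j => H ((s : ℕ), j)) ↔ g s = true} := by
      ext H; simp [hG]
    rw [this]
    refine MeasurableSet.iInter fun s => ?_
    exact (DiscretelyMeasurable.of_measurableSet (hrow s (measurableSet_honestMin honest)))
      {p | p ↔ g s = true}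
  have hset : coinPattern i₀ x A w ⁻¹' {(g, a)} = (G ×ˢ (Set.univ : Set R)) ∩
      {ω | ∀ γ < w, coinRight i₀ x A ω γ = if h : γ < w then a ⟨γ, h⟩ else fun _ => false} := by
    ext ω
    simp only [Set.mem_preimage, Set.mem_singleton_iff, coinPattern, Prod.mk.injEq, hG,
      Set.mem_inter_iff, Set.mem_prod, Set.mem_univ, and_true, Set.mem_ofPred_eq]
    refine and_congr ?_ ?_
    · rw [funext_iff]
      refine forall_congr' fun s => ?_
      change decide (HonestMin honest (row ω s)) = g s ↔ (HonestMin honest (row ω s) ↔ g s = true)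
      cases g s <;> simp
    · rw [funext_iff, Fin.forall_iff]
      refine forall₂_congr fun s hs => ?_
      rw [dif_pos hs]
  rw [hset, measureReal_def, prod_inter_coinRight_pattern x A ν ht hi₀
    (hGm.prod MeasurableSet.univ) _ w, Measure.prod_prod, measure_univ, mul_one,
    ENNReal.toReal_mul, ← measureReal_def, oracleMeasure_honestMin_pattern (by omega)]
  · congr 1
    simp
    norm_num
  · intro ω q y
    simp only [Set.mem_prod, Set.mem_univ, and_true, hG, Set.mem_ofPred_eq]
    refine forall_congr' fun s => iff_congr (iff_of_eq ?_) Iff.rfl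
    exact honestMin_congr honest (row_resample_fst ω q y s)

/-! ### The bound -/

/-- Jensen's inequality for `t ↦ t ^ l` on `t ≥ 0`. The mean factors over iterations, each
contributing `h * (1 / 2) + (1 - h) = 1 - h / 2`. -/
lemma le_sum_weights {w : ℕ} (l : ℕ) {h : ℝ} (h0 : 0 ≤ h) (h1 : h ≤ 1) :
    (1 - (1 - h / 2) ^ w) ^ l ≤ ∑ g : Fin w → Bool, (∏ s, (if g s = true then h else 1 - h)) *
      (1 - ∏ s, (if g s = true then 1 - 1 / 2 else (1 : ℝ))) ^ l := by
  have hwt : ∑ g : Fin w → Bool, ∏ s, (if g s = true then h else 1 - h) = 1 :=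
    sum_prod_bernoulli_weights h
  have hmean : ∑ g : Fin w → Bool, (∏ s, (if g s = true then h else 1 - h)) *
      (1 - ∏ s, (if g s = true then 1 - 1 / 2 else (1 : ℝ))) = 1 - (1 - h / 2) ^ w := by
    simp only [mul_sub, mul_one, Finset.sum_sub_distrib, hwt, ← Finset.prod_mul_distrib]
    congr 1
    have key := Finset.prod_univ_sum (fun _ : Fin w => (Finset.univ : Finset Bool))
      (fun _ b => (if b = true then h else 1 - h) * (if b = true then 1 - 1 / 2 else (1 : ℝ)))
    rw [Fintype.piFinset_univ] at key
    rw [← key]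
    simp
    ring
  rw [← hmean]
  refine Real.pow_arith_mean_le_arith_mean_pow _ _ _ (fun g _ => ?_) hwt (fun g _ => ?_) l
  · exact Finset.prod_nonneg fun s _ => by split_ifs <;> linarith
  · rw [sub_nonneg]
    exact Finset.prod_le_one (fun s _ => by split_ifs <;> norm_num)
      fun s _ => by split_ifs <;> norm_num

/-- A right coin of an honest winner settles its component for good, so a late end leaves an
ambiguous component that never met one in the first `w` iterations. -/
lemma lt_iterations_subset (ht : 3 * honestᶜ.card < n) (hi₀ : i₀ ∈ honest) (w : ℕ) :
    {ω | ((w + 1 : ℕ) : ℕ∞) < iterations honest x A ω} ⊆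
      (coinPattern i₀ x A w ⁻¹' {z | ∀ c ∈ ambiguous honest x, ∃ s, z.1 s = true ∧
        z.2 s c = true})ᶜ := by
  intro ω hω hgood
  obtain ⟨c, hc, hnot⟩ := exists_ambiguous_not_agree ht x A ω hω
  obtain ⟨s, hs1, hs2⟩ := hgood c hc
  have hmin : HonestMin honest (row ω s) := of_decide_eq_true hs1
  exact coin_ne_goodBit_of_not_agree ht x A ω hnot s.2 (winner_mem hi₀ (row ω s))
    (isStrictMin_winner i₀ hmin) (eq_of_beq hs2)

lemma measure_lt_iterations_le (ht : 3 * honestᶜ.card < n) (w : ℕ) :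
    ((oracleMeasure n).prod ν) {ω | ((w + 1 : ℕ) : ℕ∞) < iterations honest x A ω} ≤
      gameMeasure (ambiguous honest x).card (halfHonestRatio honest)
        {flips | (w : ℕ∞) < gameLength flips} := by
  obtain ⟨i₀, hi₀⟩ : honest.Nonempty := by
    have := card_honest_add honest
    rw [← Finset.card_pos]; omega
  refine (measure_mono (lt_iterations_subset x A ht hi₀ w)).trans ?_
  rw [← ENNReal.toReal_le_toReal (measure_ne_top _ _) (measure_ne_top _ _), ← measureReal_def,
    ← measureReal_def, gameMeasure_lt_gameLength]
  have hXm := discretelyMeasurable_coinPattern i₀ x A ht w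
  -- In terms of complements, the claim is a lower bound for the probability that every ambiguous
  -- component meets a right coin.
  rw [probReal_compl_eq_one_sub (hXm _), sub_le_sub_iff_left]
  set good : Finset ((Fin w → Bool) × (Fin w → Fin m → Bool)) :=
    Finset.univ.filter fun z => ∀ c ∈ ambiguous honest x, ∃ s, z.1 s = true ∧ z.2 s c = true
    with hgood
  have hcoe : {z : (Fin w → Bool) × (Fin w → Fin m → Bool) |
      ∀ c ∈ ambiguous honest x, ∃ s, z.1 s = true ∧ z.2 s c = true} = (good : Set _) := by
    ext z; simp [hgood]
  rw [hcoe, ← sum_measureReal_preimage_singleton good fun z _ => hXm {z}, hgood,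
    Finset.sum_filter, Fintype.sum_prod_type]
  have hn : (0 : ℝ) < n := by
    have : 0 < n := by omega
    exact_mod_cast this
  have hle : (honest.card : ℝ) / n ≤ 1 := by
    rw [div_le_one hn]
    exact_mod_cast (Finset.card_le_univ honest).trans_eq (Fintype.card_fin n)
  refine (le_sum_weights (w := w) (ambiguous honest x).card (by positivity) hle).trans_eq ?_
  refine Finset.sum_congr rfl fun g _ => ?_
  -- For fixed `g` the coins of different components are independent, which yields the exact power
  -- to which convexity was applied.
  rw [← sum_weights_columns (1 / 2) g (ambiguous honest x), Finset.mul_sum]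
  refine Finset.sum_congr rfl fun a _ => ?_
  rw [coinPattern_law x A ν ht hi₀ g a, mul_ite, mul_zero]

end Run

end MBA

/-! ### The law of the coin game and the stochastic domination. -/

theorem mainTheorem4 :
    (∀ (N : ℕ) (p : unitInterval) (w : ℕ),
      (MBA.gameMeasure N p).real {flips | (w : ℕ∞) < MBA.gameLength flips} =
        1 - (1 - (1 - (p : ℝ)) ^ w) ^ N) ∧
    (∀ {n m : ℕ} {V R : Type*} [MeasurableSpace R] (ν : Measure R) [IsProbabilityMeasure ν]
      (honest : Finset (Fin n)) (_ : 3 * honestᶜ.card < n)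
      (x : Fin n → Fin m → Option V) (A : MBA.Adversary honest m V R) (k : ℕ),
      ((MBA.oracleMeasure n).prod ν) {ω | (k : ℕ∞) < MBA.iterations honest x A ω} ≤
        MBA.gameMeasure (MBA.ambiguous honest x).card (MBA.halfHonestRatio honest)
          {flips | (k : ℕ∞) < 1 + MBA.gameLength flips}) := by
  refine ⟨MBA.gameMeasure_lt_gameLength, ?_⟩
  intro n m V R _ ν _ honest ht x A k
  cases k with
  | zero =>
    -- For `k = 0` the right-hand event is certain, because of the summand `1`.
    have : ∀ N : ℕ, {flips : ℕ → Fin N → Bool | ((0 : ℕ) : ℕ∞) < 1 + MBA.gameLength flips} =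
        Set.univ := by
      intro N
      ext flips
      simp
    rw [this, measure_univ]
    exact prob_le_one
  | succ w =>
    refine (MBA.measure_lt_iterations_le x A ν ht w).trans (measure_mono fun flips h => ?_)
    have h' : (w : ℕ∞) < MBA.gameLength flips := h
    change ((w + 1 : ℕ) : ℕ∞) < 1 + MBA.gameLength flips
    rw [Nat.cast_add, Nat.cast_one, add_comm]
    exact (ENat.add_lt_add_iff_left (by simp)).mpr h'
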